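/- All rings are associative and unital, not necessarily commutative; homomorphisms preserve $1$; $U(A)$ is the group of units of $A$. For a subset $S\subset A$, $i_S:A\to A_S=\langle A,\{x_s\}_{s\in S}\mid x_ss=sx_s=1\rangle$ is the universal localization of $A$ at $S$; for $S=\{a\}$ write $A_a$. A homomorphism $\psi$ is local if $\psi(x)$ invertible implies $x$ invertible. **Definitions.** A homomorphism $\varphi:A\to B$ with $B\neq 0$ defines a sequence $\mathcal S=(S_1,S_2,\dots)$ as follows: $A_0=A$, $\varphi_0=\varphi$, $S_{n+1}=\varphi_n^{-1}(U(B))\subset A_n$, $A_{n+1}=(A_n)_{S_{n+1}}$, and $\varphi_{n+1}:A_{n+1}\to B$ is the homomorphism extending $\varphi_n$. Sequences arising in this way are called fully invertible systems on $A$; $F(A)$ is the set of them. Put $A_{\mathcal S,n}=A_n$ and $A_{\mathcal S}=\varinjlim_n A_{\mathcal S,n}$, with natural map $i_{\mathcal S}:A\to A_{\mathcal S}$. A fraction of $A$ is a tuple $\mathbf a=(a_1,\dots,a_n)$ with $a_1\in A$, $a_2\in A_{a_1}$, $a_3\in (A_{a_1})_{a_2}$, and so on; $D(\mathbf a)$ is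 the set of $\mathcal S\in F(A)$ such that the image of $a_k$ in $A_{\mathcal S,k-1}$ lies in $S_k$ for every $k$. The sets $D(\mathbf a)$ generate the topology of $F(A)$. The structure sheaf $\mathcal O_A$ assigns to an open set $U$ the ring of all functions $t$ on $U$ with $t(\mathcal S)\in A_{\mathcal S}$ such that every point of $U$ has an open neighbourhood $U_0\subset U$ on which $t$ is given, for all $\mathcal S\in U_0$, by one noncommutative polynomial with integer coefficients in finitely many elements of $A$ and finitely many symbols $x_{s_{ij}}=s_{ij}^{-1}$, where each $s_{ij}$ is itself a fixed such polynomial in elements of $A$ and the symbols $x_{s_{pq}}$ with $p<i$, and $s_{ij}\in S_i$ for all $\mathcal S\in U_0$. A morphism of ringed spaces is local if it induces local homomorphisms on all stalks. An affine F-scheme is a ringed space isomorphic to $(F(A),\mathcal O_A)$ for some ring $A$. For a homomorphism $\varphi:A\to B$ and $\mathcal S\in F(B)$, the pull back $\varphi^*(\mathcal S)=(A\cap S_1,\;A_{A\cap S_1}\cap S_2,\dots)$ is a fully invertible system on $A$. A morphism $(f,f^\sharp):F(B)\to F(A)$ is said to be induced by $\varphi$ if, for all $\mathcal S\in F(B)$,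 $f(\mathcal S)=\varphi^*(\mathcal S)$ and there is a homomorphism $\varphi^{\mathcal S}:A_{\varphi^*(\mathcal S)}\to B_{\mathcal S}$ with $\varphi^{\mathcal S}\circ i_{\varphi^*(\mathcal S)}=i_{\mathcal S}\circ\varphi$ such that $(f^\sharp t)(\mathcal S)=\varphi^{\mathcal S}\big(t(\varphi^*(\mathcal S))\big)$ for every section $t$ of $\mathcal O_A$ over an open set containing $\varphi^*(\mathcal S)$. **Theorem.** 1. Every ring homomorphism $\varphi:A\to B$ induces a morphism of ringed spaces $(F(B),\mathcal O_B)\to(F(A),\mathcal O_A)$; it is the only morphism induced by $\varphi$, and it is local. 2. Every local morphism $(F(B),\mathcal O_B)\to(F(A),\mathcal O_A)$ is induced by a unique ring homomorphism $A\to B$. 3. Consequently, $A\mapsto F(A)$, with $\varphi$ sent to the morphism it induces, is a contravariant functor which is an anti-equivalence from the category of rings to the category of affine F-schemes and local morphisms. -/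

import Mathlib

open CategoryTheory CategoryTheory.Limits TopologicalSpace Opposite AlgebraicGeometry

universe u

namespace FSch

noncomputable section

/-! ### Universal localization of a (not necessarily commutative) ring at a subset -/

section Localization

variable {A : Type u} [Ring A] (S : Set A)

/-- The relations of the presentation `⟨A, {x_s} | x_s s = s x_s = 1 for s ∈ S⟩`:
the generators coming from `A` multiply and add as in `A`, and `x_s` is inverse to `s`. -/
inductive LocRel : FreeAlgebra ℤ (A ⊕ S) → FreeAlgebra ℤ (A ⊕ S) → Prop
  | add (a b : A) : LocRel (FreeAlgebra.ι ℤ (Sum.inl (a + b)))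
      (FreeAlgebra.ι ℤ (Sum.inl a) + FreeAlgebra.ι ℤ (Sum.inl b))
  | mul (a b : A) : LocRel (FreeAlgebra.ι ℤ (Sum.inl (a * b)))
      (FreeAlgebra.ι ℤ (Sum.inl a) * FreeAlgebra.ι ℤ (Sum.inl b))
  | one : LocRel (FreeAlgebra.ι ℤ (Sum.inl 1)) 1
  | inv_mul (s : S) :
      LocRel (FreeAlgebra.ι ℤ (Sum.inr s) * FreeAlgebra.ι ℤ (Sum.inl (s : A))) 1
  | mul_inv (s : S) :
      LocRel (FreeAlgebra.ι ℤ (Sum.inl (s : A)) * FreeAlgebra.ι ℤ (Sum.inr s)) 1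

/-- The localization `A_S` of the ring `A` at the subset `S`. -/
def Loc : Type u := RingQuot (LocRel S)

instance : Ring (Loc S) := inferInstanceAs (Ring (RingQuot (LocRel S)))

/-- The canonical homomorphism `i_S : A → A_S`. -/
def Loc.of : A →+* Loc S :=
  RingHom.mk'
    { toFun := fun a => RingQuot.mkRingHom (LocRel S) (FreeAlgebra.ι ℤ (Sum.inl a))
      map_one' := by
        rw [RingQuot.mkRingHom_rel LocRel.one, map_one]; rfl
      map_mul' := fun a b => by
        rw [RingQuot.mkRingHom_rel (LocRel.mul a b), map_mul]; rfl }
    (fun a b => by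
      change RingQuot.mkRingHom (LocRel S) _ = _
      rw [RingQuot.mkRingHom_rel (LocRel.add a b), map_add]; rfl)

theorem Loc.isUnit_of {s : A} (hs : s ∈ S) : IsUnit (Loc.of S s) :=
  ⟨⟨Loc.of S s, RingQuot.mkRingHom (LocRel S) (FreeAlgebra.ι ℤ (Sum.inr ⟨s, hs⟩)),
    by
      have h := RingQuot.mkRingHom_rel (LocRel.mul_inv (S := S) ⟨s, hs⟩)
      rw [map_mul, map_one] at h
      exact h,
    by
      have h := RingQuot.mkRingHom_rel (LocRel.inv_mul (S := S) ⟨s, hs⟩)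
      rw [map_mul, map_one] at h
      exact h⟩, rfl⟩

variable {S} {B : Type u} [Ring B]

/-- The homomorphism `A_S → B` induced by `φ : A → B` with `φ(S)` invertible. -/
def Loc.lift (φ : A →+* B) (h : ∀ s ∈ S, IsUnit (φ s)) : Loc S →+* B :=
  RingQuot.lift
    ⟨((FreeAlgebra.lift ℤ) (Sum.elim (fun a => φ a)
        (fun s => (((h s.1 s.2).unit⁻¹ : Bˣ) : B)))).toRingHom, by
      intro x y hxy
      cases hxy with
      | add a b => simp
      | mul a b => simp
      | one => simp
      | inv_mul s => simp
      | mul_inv s => simp⟩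

theorem Loc.lift_of (φ : A →+* B) (h : ∀ s ∈ S, IsUnit (φ s)) (a : A) :
    Loc.lift φ h (Loc.of S a) = φ a := by
  change RingQuot.lift _ (RingQuot.mkRingHom (LocRel S) _) = _
  rw [RingQuot.lift_mkRingHom_apply]
  simp

/-- A homomorphism out of `A_S` is determined by its restriction to `A`. -/
theorem Loc.hom_ext {f g : Loc S →+* B} (h : f.comp (Loc.of S) = g.comp (Loc.of S)) :
    f = g := by
  have hA : ∀ a, f (Loc.of S a) = g (Loc.of S a) := fun a => congrArg (fun k => k a) h
  have key : (f.comp (RingQuot.mkRingHom (LocRel S))).toIntAlgHom =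
      (g.comp (RingQuot.mkRingHom (LocRel S))).toIntAlgHom := by
    apply FreeAlgebra.hom_ext
    funext v
    rcases v with a | s
    · exact hA a
    · change f (RingQuot.mkRingHom (LocRel S) _) = g (RingQuot.mkRingHom (LocRel S) _)
      have h1 := RingQuot.mkRingHom_rel (LocRel.inv_mul (S := S) s)
      have h2 := RingQuot.mkRingHom_rel (LocRel.mul_inv (S := S) s)
      rw [map_mul, map_one] at h1 h2
      change _ * Loc.of S s.1 = 1 at h1
      change Loc.of S s.1 * _ = 1 at h2
      have e1 := congrArg f h1
      have e2 := congrArg g h2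
      erw [map_mul, map_one] at e1 e2
      rw [← hA] at e2
      exact left_inv_eq_right_inv e1 e2
  apply RingQuot.ringQuot_ext
  ext x
  exact congrArg (fun k => k x) key

/-- The homomorphism `A_S → B_T` induced by `φ : A → B` with `φ(S) ⊆ T`. -/
def Loc.map {T : Set B} (φ : A →+* B) (h : ∀ s ∈ S, φ s ∈ T) : Loc S →+* Loc T :=
  Loc.lift ((Loc.of T).comp φ) (fun s hs => Loc.isUnit_of T (h s hs))

theorem Loc.map_of {T : Set B} (φ : A →+* B) (h : ∀ s ∈ S, φ s ∈ T) (a : A) :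
    Loc.map φ h (Loc.of S a) = Loc.of T (φ a) :=
  Loc.lift_of _ _ a

end Localization

/-! ### Sequences of subsets in iterated localizations -/

/-- A family of rings. -/
structure RingFamily where
  Idx : Type u
  ring : Idx → Type u
  inst : ∀ i, Ring (ring i)

attribute [instance] RingFamily.inst

/-- `tower A n` is the family indexed by the sequences `(S₁, …, Sₙ)` with `S₁ ⊆ A` and
`Sₖ₊₁ ⊆ (…(A_{S₁})…)_{Sₖ}`; the ring attached to `(S₁, …, Sₙ)` is `(…(A_{S₁})…)_{Sₙ}`. -/
def tower (A : Type u) [Ring A] : ℕ → RingFamily.{u}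
  | 0 => ⟨PUnit, fun _ => A, fun _ => inferInstance⟩
  | n + 1 => ⟨Σ t : (tower A n).Idx, Set ((tower A n).ring t), fun p => Loc p.2,
      fun _ => inferInstance⟩

/-- The identification of the rings attached to equal indices. -/
def castHom {F : RingFamily.{u}} {i j : F.Idx} (h : i = j) : F.ring i →+* F.ring j :=
  h ▸ RingHom.id (F.ring i)

section System

variable {A B C : Type u} [Ring A] [Ring B] [Ring C]

/-- The first `n` steps of the system coming from `φ : A → B`: the sequence `(S₁, …, Sₙ)` with
`Sₖ₊₁ = φₖ⁻¹(U(B))`, together with the homomorphism `φₙ : Aₙ → B` extending `φ`. -/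
def systemAux (φ : A →+* B) : (n : ℕ) → Σ t : (tower A n).Idx, ((tower A n).ring t →+* B)
  | 0 => ⟨PUnit.unit, φ⟩
  | n + 1 => ⟨⟨(systemAux φ n).1, {a | IsUnit ((systemAux φ n).2 a)}⟩,
      Loc.lift (systemAux φ n).2 (fun _ hs => hs)⟩

/-- The system coming from `φ : A → B`, given by its initial segments. -/
def system (φ : A →+* B) (n : ℕ) : (tower A n).Idx := (systemAux φ n).1

variable (A) in
/-- The full spectrum `F(A)`: the set of fully invertible systems on `A`, that is, of the sequences
(given by their initial segments) which come from a homomorphism from `A` to a nonzero ring. -/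
def FullSpectrum : Type u :=
  { s : ∀ n, (tower A n).Idx //
    ∃ (B : Type u) (_ : Ring B) (_ : Nontrivial B) (φ : A →+* B), s = system φ }

namespace FullSpectrum

/-- The ring `A_{S,n}`. -/
abbrev ring (S : FullSpectrum A) (n : ℕ) : Type u := (tower A n).ring (S.1 n)

theorem step (S : FullSpectrum A) (n : ℕ) : S.1 n = (S.1 (n + 1)).1 := by
  obtain ⟨s, B, _, _, φ, rfl⟩ := S
  rfl

/-- The subset `S_{n+1}` of `A_{S,n}`. -/
def set (S : FullSpectrum A) (n : ℕ) : Set (S.ring n) :=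
  {a | castHom (S.step n) a ∈ (S.1 (n + 1)).2}

/-- The natural homomorphism `A_{S,n} → A_{S,n+1} = (A_{S,n})_{S_{n+1}}`. -/
def transition (S : FullSpectrum A) (n : ℕ) : S.ring n →+* S.ring (n + 1) :=
  (Loc.of (S.1 (n + 1)).2).comp (castHom (S.step n))

/-- The direct system `A = A_{S,0} → A_{S,1} → A_{S,2} → ⋯`. -/
def diagram (S : FullSpectrum A) : ℕ ⥤ RingCat.{u} :=
  Functor.ofSequence (X := fun n => RingCat.of (S.ring n))
    (fun n => RingCat.ofHom (S.transition n))

/-- The localization `A_S` of `A` at the fully invertible system `S`. -/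
def loc (S : FullSpectrum A) : Type u := (colimit S.diagram : RingCat.{u})

instance locRing (S : FullSpectrum A) : Ring S.loc :=
  inferInstanceAs (Ring (colimit S.diagram : RingCat.{u}))

/-- The natural homomorphism `A_{S,n} → A_S`. -/
def toLoc (S : FullSpectrum A) (n : ℕ) : S.ring n →+* S.loc := (colimit.ι S.diagram n).hom

/-- The natural homomorphism `i_S : A → A_S`. -/
def of (S : FullSpectrum A) : A →+* S.loc := S.toLoc 0

end FullSpectrum

/-- The first `n` steps of the pull back along `φ : A → B` of a sequence `s` on `B`: the sequence
`(A ∩ S₁, A_{A ∩ S₁} ∩ S₂, …)` together with the natural homomorphism from the `n`-th ring it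
defines over `A` to the `n`-th ring that `s` defines over `B`. -/
def pullbackAux (φ : A →+* B) : (n : ℕ) → (s : (tower B n).Idx) →
    Σ t : (tower A n).Idx, ((tower A n).ring t →+* (tower B n).ring s)
  | 0, _ => ⟨PUnit.unit, φ⟩
  | n + 1, s => ⟨⟨(pullbackAux φ n s.1).1, (pullbackAux φ n s.1).2 ⁻¹' s.2⟩,
      Loc.map (pullbackAux φ n s.1).2 (fun _ h => h)⟩

theorem pullbackAux_system (φ : A →+* B) (ψ : B →+* C) (n : ℕ) :
    (⟨(pullbackAux φ n (system ψ n)).1,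
      (systemAux ψ n).2.comp (pullbackAux φ n (system ψ n)).2⟩ :
      Σ t : (tower A n).Idx, ((tower A n).ring t →+* C)) = systemAux (ψ.comp φ) n := by
  induction n with
  | zero => rfl
  | succ n ih =>
    have e : systemAux (ψ.comp φ) (n + 1) =
        (fun p : Σ t : (tower A n).Idx, ((tower A n).ring t →+* C) =>
          (⟨⟨p.1, {a | IsUnit (p.2 a)}⟩, Loc.lift p.2 (fun _ hs => hs)⟩ :
            Σ t : (tower A (n + 1)).Idx, ((tower A (n + 1)).ring t →+* C)))
          (systemAux (ψ.comp φ) n) := rfl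
    rw [e, ← ih]
    refine Sigma.ext rfl (heq_of_eq ?_)
    apply Loc.hom_ext
    ext a
    exact (congrArg (systemAux ψ (n + 1)).2 (Loc.map_of _ (fun _ h => h) a)).trans
      ((Loc.lift_of (systemAux ψ n).2 (fun _ hs => hs) _).trans (Loc.lift_of
        ((systemAux ψ n).2.comp (pullbackAux φ n (system ψ n)).2) (fun _ hs => hs) a).symm)

/-- The pull back `φ^*(S)` to `A` of a fully invertible system `S` on `B`, along `φ : A → B`. -/
def FullSpectrum.comap (φ : A →+* B) (S : FullSpectrum B) : FullSpectrum A :=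
  ⟨fun n => (pullbackAux φ n (S.1 n)).1, by
    obtain ⟨s, C, _, _, ψ, rfl⟩ := S
    exact ⟨C, inferInstance, inferInstance, ψ.comp φ,
      funext fun n => congrArg Sigma.fst (pullbackAux_system φ ψ n)⟩⟩

end System

/-! ### The topology of the full spectrum -/

section Topology

/-- `fracTower A n` is the family indexed by the fractions `(a₁, …, aₙ)` of `A`, where `a₁ ∈ A` and
`aₖ₊₁ ∈ (…(A_{a₁})…)_{aₖ}`; the ring attached to `(a₁, …, aₙ)` is `(…(A_{a₁})…)_{aₙ}`. -/
def fracTower (A : Type u) [Ring A] : ℕ → RingFamily.{u}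
  | 0 => ⟨PUnit, fun _ => A, fun _ => inferInstance⟩
  | n + 1 => ⟨Σ t : (fracTower A n).Idx, (fracTower A n).ring t,
      fun p => Loc ({p.2} : Set ((fracTower A n).ring p.1)), fun _ => inferInstance⟩

variable {A : Type u} [Ring A]

/-- For a fraction `(a₁, …, aₙ)` and a sequence `(S₁, …, Sₙ)`: the image of each `aₖ` lies in `Sₖ`,
and `f` is the resulting natural homomorphism from the `n`-th ring of the fraction to the `n`-th
ring of the sequence. -/
def FracHom : (n : ℕ) → (a : (fracTower A n).Idx) → (s : (tower A n).Idx) →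
    ((fracTower A n).ring a →+* (tower A n).ring s) → Prop
  | 0, _, _, f => f = RingHom.id A
  | n + 1, a, s, f => ∃ g : (fracTower A n).ring a.1 →+* (tower A n).ring s.1,
      FracHom n a.1 s.1 g ∧ g a.2 ∈ s.2 ∧
        f.comp (Loc.of ({a.2} : Set ((fracTower A n).ring a.1))) = (Loc.of s.2).comp g

/-- The fundamental open subset `D(a) = {S | a ∈ S}` of a fraction `a = (a₁, …, aₙ)`. -/
def fundamentalOpen {n : ℕ} (a : (fracTower A n).Idx) : Set (FullSpectrum A) :=
  {S | ∃ f, FracHom n a (S.1 n) f}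

instance : TopologicalSpace (FullSpectrum A) :=
  TopologicalSpace.generateFrom
    {U | ∃ (n : ℕ) (a : (fracTower A n).Idx), U = fundamentalOpen a}

end Topology

/-! ### The structure sheaf -/

section StructureSheaf

/-- A noncommutative polynomial `num` with integral coefficients in elements of `A` and in symbols
`x_i` (`i ∈ ι`, `ι` finite), where `x_i` stands for the inverse of `den i`, which is itself such a
polynomial involving only symbols of level smaller than the level of `i`.
Levels are counted from `0`. -/
structure PolyPresentation (A : Type u) [Ring A] where
  ι : Type
  finite : Finite ι
  level : ι → ℕ
  den : ι → FreeAlgebra ℤ (A ⊕ ι)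
  depends : ∀ i, den i ∈ Algebra.adjoin ℤ
    (FreeAlgebra.ι ℤ '' {v : A ⊕ ι | ∀ j, v = Sum.inr j → level j < level i})
  num : FreeAlgebra ℤ (A ⊕ ι)

theorem depends_map {A : Type u} {ι κ : Type} (g : ι → κ) (l : κ → ℕ) (m : ℕ)
    {p : FreeAlgebra ℤ (A ⊕ ι)}
    (hp : p ∈ Algebra.adjoin ℤ
      (FreeAlgebra.ι ℤ '' {v : A ⊕ ι | ∀ j, v = Sum.inr j → l (g j) < m})) :
    FreeAlgebra.lift ℤ (FreeAlgebra.ι ℤ ∘ Sum.map id g) p ∈ Algebra.adjoin ℤ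
      (FreeAlgebra.ι ℤ '' {v : A ⊕ κ | ∀ j, v = Sum.inr j → l j < m}) := by
  have h := Subalgebra.mem_map.mpr ⟨p, hp, (rfl :
    FreeAlgebra.lift ℤ (FreeAlgebra.ι ℤ ∘ Sum.map id g) p = _)⟩
  rw [AlgHom.map_adjoin (FreeAlgebra.lift ℤ (FreeAlgebra.ι ℤ ∘ Sum.map id g))] at h
  refine Algebra.adjoin_mono ?_ h
  rintro _ ⟨_, ⟨v, hv, rfl⟩, rfl⟩
  refine ⟨Sum.map id g v, ?_, by simp⟩
  rintro j hj
  rcases v with a | i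
  · simp at hj
  · simp only [Sum.map_inr, Sum.inr.injEq] at hj
    subst hj
    exact hv i rfl

variable {A : Type u} [Ring A]

/-- Evaluation of polynomials in elements of `A` and symbols `x_i` in the ring `A_S`. -/
def evalLoc (S : FullSpectrum A) {ι : Type} (x : ι → S.loc) :
    FreeAlgebra ℤ (A ⊕ ι) →ₐ[ℤ] S.loc :=
  FreeAlgebra.lift ℤ (Sum.elim (fun a => S.of a) x)

/-- `x` is the family of inverses `x_i = s_i⁻¹` in `A_S`, where `s_i`, the value of `den i`, lies
in the subset `S_{k+1}` of `A_{S,k}` for `k` the level of `i`. -/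
def PolyPresentation.IsSol (P : PolyPresentation A) (S : FullSpectrum A)
    (x : P.ι → S.loc) : Prop :=
  ∀ i, (∃ s ∈ S.set (P.level i), S.toLoc (P.level i) s = evalLoc S x (P.den i)) ∧
    evalLoc S x (P.den i) * x i = 1 ∧ x i * evalLoc S x (P.den i) = 1

/-- `P` presents the element `y` of `A_S`. -/
def PolyPresentation.Presents (P : PolyPresentation A) (S : FullSpectrum A) (y : S.loc) : Prop :=
  ∃ x, P.IsSol S x ∧ y = evalLoc S x P.num

variable (A) in
/-- `F(A)` as a topological space. -/
def FTop : TopCat.{u} := TopCat.of (FullSpectrum A)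

/-- The stalk family `S ↦ A_S` on `F(A)`. -/
def locAt (S : FTop A) : Type u := FullSpectrum.loc (A := A) S

instance (S : FTop A) : Ring (locAt S) := FullSpectrum.locRing (A := A) S

variable (A) in
/-- Functions `t` on an open set with `t(S) ∈ A_S` that are given by one polynomial presentation
on the whole open set. -/
def presentedPrelocal : TopCat.PrelocalPredicate (locAt (A := A)) where
  pred {U} t := ∃ P : PolyPresentation A, ∀ S : U, P.Presents S.1 (t S)
  res := by
    rintro U V i t ⟨P, hP⟩
    exact ⟨P, fun S => hP (i S)⟩

variable (A) in
/-- Functions `t` with `t(S) ∈ A_S` that, near each point, are given by one polynomial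
presentation. -/
def presentedLocal : TopCat.LocalPredicate (locAt (A := A)) := (presentedPrelocal A).sheafify

theorem evalLoc_map (S : FullSpectrum A) {ι κ : Type} (g : ι → κ) (x : κ → S.loc)
    (p : FreeAlgebra ℤ (A ⊕ ι)) :
    evalLoc S x (FreeAlgebra.lift ℤ (FreeAlgebra.ι ℤ ∘ Sum.map id g) p) =
      evalLoc S (x ∘ g) p := by
  have h : (evalLoc S x).comp (FreeAlgebra.lift ℤ (FreeAlgebra.ι ℤ ∘ Sum.map id g)) =
      evalLoc S (x ∘ g) := by
    apply FreeAlgebra.hom_ext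
    funext v
    rcases v with a | i <;> simp [evalLoc]
  exact congrArg (fun k => k p) h

/-- The presentation using the symbols of both `P` and `Q` and with numerator
`c p q`, where `p`, `q` are the numerators of `P` and `Q`. -/
def PolyPresentation.combine (P Q : PolyPresentation A)
    (c : FreeAlgebra ℤ (A ⊕ (P.ι ⊕ Q.ι)) → FreeAlgebra ℤ (A ⊕ (P.ι ⊕ Q.ι)) →
      FreeAlgebra ℤ (A ⊕ (P.ι ⊕ Q.ι))) : PolyPresentation A where
  ι := P.ι ⊕ Q.ι
  finite := by
    have := P.finite
    have := Q.finite
    infer_instance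
  level := Sum.elim P.level Q.level
  den := Sum.elim
    (fun i => FreeAlgebra.lift ℤ (FreeAlgebra.ι ℤ ∘ Sum.map id Sum.inl) (P.den i))
    (fun i => FreeAlgebra.lift ℤ (FreeAlgebra.ι ℤ ∘ Sum.map id Sum.inr) (Q.den i))
  depends := by
    rintro (i | i)
    · exact depends_map Sum.inl _ _ (P.depends i)
    · exact depends_map Sum.inr _ _ (Q.depends i)
  num := c (FreeAlgebra.lift ℤ (FreeAlgebra.ι ℤ ∘ Sum.map id Sum.inl) P.num)
    (FreeAlgebra.lift ℤ (FreeAlgebra.ι ℤ ∘ Sum.map id Sum.inr) Q.num)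

theorem PolyPresentation.presents_combine {P Q : PolyPresentation A} {S : FullSpectrum A}
    {y z w : S.loc} (hP : P.Presents S y) (hQ : Q.Presents S z)
    (c : FreeAlgebra ℤ (A ⊕ (P.ι ⊕ Q.ι)) → FreeAlgebra ℤ (A ⊕ (P.ι ⊕ Q.ι)) →
      FreeAlgebra ℤ (A ⊕ (P.ι ⊕ Q.ι)))
    (hc : ∀ (x : P.ι ⊕ Q.ι → S.loc) (p q : FreeAlgebra ℤ (A ⊕ (P.ι ⊕ Q.ι))),
      evalLoc S x p = y → evalLoc S x q = z → w = evalLoc S x (c p q)) :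
    (P.combine Q c).Presents S w := by
  obtain ⟨x, hx, rfl⟩ := hP
  obtain ⟨x', hx', rfl⟩ := hQ
  refine ⟨Sum.elim x x', ?_, hc _ _ _ (evalLoc_map S Sum.inl _ _) (evalLoc_map S Sum.inr _ _)⟩
  rintro (i | i)
  · have e : evalLoc S (Sum.elim x x') ((P.combine Q c).den (Sum.inl i)) =
        evalLoc S x (P.den i) := evalLoc_map S Sum.inl _ _
    refine ⟨?_, ?_, ?_⟩
    · obtain ⟨s, hs, hs'⟩ := (hx i).1
      exact ⟨s, hs, hs'.trans e.symm⟩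
    · exact (congrArg (· * x i) e).trans (hx i).2.1
    · exact (congrArg (x i * ·) e).trans (hx i).2.2
  · have e : evalLoc S (Sum.elim x x') ((P.combine Q c).den (Sum.inr i)) =
        evalLoc S x' (Q.den i) := evalLoc_map S Sum.inr _ _
    refine ⟨?_, ?_, ?_⟩
    · obtain ⟨s, hs, hs'⟩ := (hx' i).1
      exact ⟨s, hs, hs'.trans e.symm⟩
    · exact (congrArg (· * x' i) e).trans (hx' i).2.1
    · exact (congrArg (x' i * ·) e).trans (hx' i).2.2

/-- The presentation given by a polynomial in elements of `A` only. -/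
def PolyPresentation.ofPoly (p : FreeAlgebra ℤ (A ⊕ Empty)) : PolyPresentation A where
  ι := Empty
  finite := inferInstance
  level := Empty.elim
  den := Empty.elim
  depends := fun i => i.elim
  num := p

theorem PolyPresentation.presents_ofPoly (p : FreeAlgebra ℤ (A ⊕ Empty)) (S : FullSpectrum A) :
    (PolyPresentation.ofPoly p).Presents S (evalLoc S Empty.elim p) :=
  ⟨Empty.elim, fun i => i.elim, rfl⟩

theorem presentedLocal_op {U : Opens (FTop A)} {s t : ∀ S : U, locAt S.1}
    (hs : (presentedLocal A).pred s) (ht : (presentedLocal A).pred t)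
    (o : ∀ S : FullSpectrum A, S.loc → S.loc → S.loc)
    (c : ∀ ι : Type, FreeAlgebra ℤ (A ⊕ ι) → FreeAlgebra ℤ (A ⊕ ι) → FreeAlgebra ℤ (A ⊕ ι))
    (hc : ∀ (S : FullSpectrum A) (ι : Type) (x : ι → S.loc) (p q : FreeAlgebra ℤ (A ⊕ ι)),
      o S (evalLoc S x p) (evalLoc S x q) = evalLoc S x (c ι p q)) :
    (presentedLocal A).pred (fun S : U => o S.1 (s S) (t S)) := by
  intro S
  obtain ⟨V, mV, iV, P, hP⟩ := hs S
  obtain ⟨W, mW, iW, Q, hQ⟩ := ht S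
  refine ⟨V ⊓ W, ⟨mV, mW⟩, Opens.infLELeft _ _ ≫ iV, P.combine Q (c _), fun T => ?_⟩
  refine PolyPresentation.presents_combine (hP ⟨T.1, T.2.1⟩) (hQ ⟨T.1, T.2.2⟩) _ ?_
  intro x p q hp hq
  exact (congrArg₂ (o T.1) hp hq).symm.trans (hc T.1 _ x p q)

theorem presentedLocal_poly {U : Opens (FTop A)} (p : FreeAlgebra ℤ (A ⊕ Empty)) :
    (presentedLocal A).pred (fun S : U => evalLoc (A := A) S.1 Empty.elim p) := fun S =>
  ⟨U, S.2, 𝟙 _, PolyPresentation.ofPoly p,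
    fun T => PolyPresentation.presents_ofPoly p (T.1 : FullSpectrum A)⟩

/-- The ring `𝒪_A(U)` of sections over `U`, with pointwise operations. -/
def sections (U : Opens (FTop A)) : Subring (∀ S : U, locAt S.1) where
  carrier := {t | (presentedLocal A).pred t}
  mul_mem' {s t} hs ht := presentedLocal_op hs ht (fun _ y z => y * z) (fun _ p q => p * q)
    (fun S _ x p q => (map_mul (evalLoc S x) p q).symm)
  add_mem' {s t} hs ht := presentedLocal_op hs ht (fun _ y z => y + z) (fun _ p q => p + q)
    (fun S _ x p q => (map_add (evalLoc S x) p q).symm)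
  neg_mem' {s} hs := presentedLocal_op hs hs (fun _ y _ => -y) (fun _ p _ => -p)
    (fun S _ x p _ => (map_neg (evalLoc S x) p).symm)
  one_mem' := by
    have h := presentedLocal_poly (A := A) (U := U) 1
    have e : ∀ T : FullSpectrum A, evalLoc T Empty.elim 1 = 1 := fun T => map_one _
    exact (show (fun S : U => evalLoc (A := A) S.1 Empty.elim 1) = (1 : ∀ S : U, locAt S.1) from
      funext fun S => e S.1) ▸ h
  zero_mem' := by
    have h := presentedLocal_poly (A := A) (U := U) 0
    have e : ∀ T : FullSpectrum A, evalLoc T Empty.elim 0 = 0 := fun T => map_zero _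
    exact (show (fun S : U => evalLoc (A := A) S.1 Empty.elim 0) = (0 : ∀ S : U, locAt S.1) from
      funext fun S => e S.1) ▸ h

variable (A) in
/-- The presheaf of rings `U ↦ 𝒪_A(U)` on `F(A)`, with restriction of functions. -/
def structurePresheaf : TopCat.Presheaf RingCat.{u} (FTop A) where
  obj U := RingCat.of (sections U.unop)
  map {U V} i := RingCat.ofHom
    { toFun := fun t => ⟨fun S => t.1 (i.unop S), (presentedLocal A).res i.unop t.1 t.2⟩
      map_one' := rfl
      map_mul' := fun _ _ => rfl
      map_zero' := rfl
      map_add' := fun _ _ => rfl }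

variable (A) in
theorem structurePresheaf_isSheaf : (structurePresheaf A).IsSheaf := by
  rw [TopCat.Presheaf.isSheaf_iff_isSheaf_comp (forget RingCat.{u})]
  exact TopCat.Presheaf.isSheaf_of_iso
    (NatIso.ofComponents (fun _ => Iso.refl _) :
      (TopCat.subsheafToTypes (presentedLocal A)).1 ≅ structurePresheaf A ⋙ forget RingCat.{u})
    (TopCat.subsheafToTypes (presentedLocal A)).2

variable (A) in
/-- The ringed space `(F(A), 𝒪_A)`. -/
def F : SheafedSpace RingCat.{u} where
  carrier := FTop A
  presheaf := structurePresheaf A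
  IsSheaf := structurePresheaf_isSheaf A

/-- The value in `A_S` of a section over `U` of the structure sheaf at a point `S` of `U`. -/
def value {U : Opens (F A)} (t : (F A).presheaf.obj (op U)) (S : FullSpectrum A)
    (hS : (S : F A) ∈ U) : S.loc :=
  (show sections (A := A) U from t).1 ⟨S, hS⟩

end StructureSheaf

/-! ### Local morphisms and affine F-schemes -/

/-- A morphism of (possibly noncommutative) ringed spaces is local if it induces local
homomorphisms on the stalks. -/
def IsLocalMorphism {X Y : SheafedSpace RingCat.{u}} (f : X ⟶ Y) : Prop :=
  ∀ x : X, IsLocalHom (f.hom.stalkMap x).hom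

/-- The morphism `f : F(B) → F(A)` is the one induced by the ring homomorphism `φ : A → B`: on
points it is the pull back `S ↦ φ^*(S)`, and on sections it is given by composing with the natural
homomorphisms `ψ = φ^S : A_{φ^*(S)} → B_S` that extend `φ`, i.e. `(f^♯ t)(S) = φ^S (t (φ^*(S)))`. -/
def IsInducedBy {A B : Type u} [Ring A] [Ring B] (φ : A →+* B) (f : F B ⟶ F A) : Prop :=
  ∀ S : FullSpectrum B, ∃ hS : f.hom.base (S : F B) = FullSpectrum.comap φ S,
    ∃ ψ : (FullSpectrum.comap φ S).loc →+* S.loc,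
      ψ.comp (FullSpectrum.comap φ S).of = S.of.comp φ ∧
      ∀ (U : Opens (F A)) (t : (F A).presheaf.obj (op U))
        (hU : (FullSpectrum.comap φ S : F A) ∈ U),
        value (f.hom.c.app (op U) t) S (show f.hom.base (S : F B) ∈ U by rw [hS]; exact hU) =
          ψ (value t (FullSpectrum.comap φ S) hU)

/-- An affine F-scheme: a ringed space isomorphic to `F(A)` for some ring `A`. -/
structure AffineFScheme where
  toSheafedSpace : SheafedSpace RingCat.{u}
  isAffine : ∃ (A : Type u) (_ : Ring A), Nonempty (toSheafedSpace ≅ F A)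

theorem IsLocalMorphism.id (X : SheafedSpace RingCat.{u}) : IsLocalMorphism (𝟙 X) := by
  intro x
  change IsLocalHom (PresheafedSpace.Hom.stalkMap (𝟙 X.toPresheafedSpace) x).hom
  rw [PresheafedSpace.stalkMap.id]
  exact ⟨fun _ h => h⟩

theorem IsLocalMorphism.comp {X Y Z : SheafedSpace RingCat.{u}} {f : X ⟶ Y} {g : Y ⟶ Z}
    (hf : IsLocalMorphism f) (hg : IsLocalMorphism g) : IsLocalMorphism (f ≫ g) := by
  intro x
  change IsLocalHom (PresheafedSpace.Hom.stalkMap (f.hom ≫ g.hom) x).hom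
  rw [PresheafedSpace.stalkMap.comp]
  exact ⟨fun a h => (hg _).map_nonunit a ((hf x).map_nonunit _ h)⟩

/-- The category of affine F-schemes and local morphisms. -/
instance : Category AffineFScheme.{u} where
  Hom X Y := {f : X.toSheafedSpace ⟶ Y.toSheafedSpace // IsLocalMorphism f}
  id X := ⟨𝟙 _, IsLocalMorphism.id _⟩
  comp f g := ⟨f.1 ≫ g.1, f.2.comp g.2⟩

/-- `F(A)` as an affine F-scheme. -/
def affineF (A : Type u) [Ring A] : AffineFScheme.{u} := ⟨F A, A, inferInstance, ⟨Iso.refl _⟩⟩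

end

end FSch

/-!
The proof rests on describing points and sections of `F(A)` through homomorphisms out of `A`.

A fully invertible system `S` is determined by any homomorphism `A → R` that has `S` as its system,
and composing with a local homomorphism does not change the system (`system_comp`). Conversely,
`A → R` with system `S` extends uniquely to `A_S`, and the extension is local
(`FullSpectrum.exists_loc_lift`, `FullSpectrum.loc_hom_ext`). Thus `S` is the system of `A → A_S`,
and `φ^*(S)` is the system of `A → B → B_S`. Membership in `S` at any level means invertibility in
`A_S`, so the conditions on levels disappear both from fractions (`mem_fundamentalOpen_iff`) and
from polynomial presentations (`PolyPresentation.isSol_iff`), whose solutions are unique.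

A presentation that is solvable in `A_S` is solvable over the ring of a fraction in `S`, hence near
`S` (`PolyPresentation.Solves.exists_isOpen`). Adding a symbol for the inverse of the numerator
shows that a germ at `S` is invertible as soon as its value in `A_S` is. Therefore `A → 𝒪_{A,S}` has
the system `S`, and the resulting map `A_S → 𝒪_{A,S}` is inverse to evaluation: the stalk at `S` is
`A_S`.

The point of the identity `A → A` has no neighbourhood but `F(A)`, and its stalk is `A`. So `A` is
the ring of global sections (`constSection_top_bijective`). A local morphism `f : F(B) → F(A)`
thus gives `φ : A → B` on global sections, and the local homomorphism `A_{f(S)} ≅ 𝒪_{A,f(S)} →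
𝒪_{B,S} → B_S` over `φ` shows that `f(S) = φ^*(S)` and that `f` is induced by `φ`
(`IsLocalMorphism.isInducedBy`). In the other direction `φ` acts on points by pull back, which is
continuous since the preimage of `D(a)` is `D(φ(a))`, and on sections through `A_{φ^*(S)} → B_S`.
That induced morphisms are exactly the local ones with a given map on global sections makes
composition, and with it the anti-equivalence, immediate.
-/

namespace FSch

noncomputable section

/-! ### Systems and local homomorphisms -/

section Systems

variable {A B R R' : Type u} [Ring A] [Ring B] [Ring R] [Ring R']

/-- Composing with a local homomorphism does not change the set of elements that become
invertible, at any stage; hence it does not change the system. -/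
theorem systemAux_comp (h : A →+* R) (l : R →+* R') [IsLocalHom l] (n : ℕ) :
    systemAux (l.comp h) n = ⟨(systemAux h n).1, l.comp (systemAux h n).2⟩ := by
  induction n with
  | zero => rfl
  | succ n ih =>
    have e : systemAux (l.comp h) (n + 1) =
        (fun p : Σ t : (tower A n).Idx, ((tower A n).ring t →+* R') =>
          (⟨⟨p.1, {a | IsUnit (p.2 a)}⟩, Loc.lift p.2 (fun _ hs => hs)⟩ :
            Σ t : (tower A (n + 1)).Idx, ((tower A (n + 1)).ring t →+* R')))
          (systemAux (l.comp h) n) := rfl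
    rw [e, ih]
    -- both sides are localizations of one ring, at sets that agree because `l` is local
    have key : ∀ (T : Set ((tower A n).ring (systemAux h n).1))
        (hT : T = {a | IsUnit ((systemAux h n).2 a)})
        (k : Loc T →+* R') (_ : k.comp (Loc.of T) = l.comp (systemAux h n).2),
        (⟨⟨(systemAux h n).1, T⟩, k⟩ :
          Σ t : (tower A (n + 1)).Idx, ((tower A (n + 1)).ring t →+* R')) =
          ⟨(systemAux h (n + 1)).1, l.comp (systemAux h (n + 1)).2⟩ := by
      rintro T rfl k hk
      refine Sigma.ext rfl (heq_of_eq ?_)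
      apply Loc.hom_ext
      refine hk.trans ?_
      ext a
      exact (congrArg l (Loc.lift_of (systemAux h n).2 (fun _ hs => hs) a)).symm
    refine key _ ?_ _ ?_
    · ext a
      exact isUnit_map_iff l _
    · ext a
      exact Loc.lift_of (l.comp (systemAux h n).2) (fun _ hs => hs) a

theorem system_comp (h : A →+* R) (l : R →+* R') [IsLocalHom l] :
    system (l.comp h) = system h :=
  funext fun n => congrArg Sigma.fst (systemAux_comp h l n)

/-- The point of `F(A)` defined by a homomorphism to a nonzero ring. -/
def FullSpectrum.point [Nontrivial R] (h : A →+* R) : FullSpectrum A :=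
  ⟨system h, R, inferInstance, inferInstance, h, rfl⟩

namespace FullSpectrum

theorem toLoc_comp_transition (S : FullSpectrum A) (n : ℕ) :
    (S.toLoc (n + 1)).comp (S.transition n) = S.toLoc n := by
  have h := colimit.w S.diagram (homOfLE (Nat.le_succ n))
  have e : S.diagram.map (homOfLE (Nat.le_succ n)) = RingCat.ofHom (S.transition n) :=
    Functor.ofSequence_map_homOfLE_succ _ n
  rw [e] at h
  exact congrArg RingCat.Hom.hom h

theorem toLoc_transition (S : FullSpectrum A) (n : ℕ) (a : S.ring n) :
    S.toLoc (n + 1) (S.transition n a) = S.toLoc n a :=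
  congrArg (fun k => k a) (S.toLoc_comp_transition n)

theorem exists_toLoc_eq (S : FullSpectrum A) (x : S.loc) : ∃ n a, S.toLoc n a = x := by
  have := preservesSmallestFilteredColimits_of_preservesFilteredColimits (forget RingCat.{u})
  exact Concrete.colimit_exists_rep S.diagram x

theorem isUnit_transition (S : FullSpectrum A) {n : ℕ} {a : S.ring n} (ha : a ∈ S.set n) :
    IsUnit (S.transition n a) :=
  Loc.isUnit_of _ ha

theorem isUnit_toLoc (S : FullSpectrum A) {n : ℕ} {a : S.ring n} (ha : a ∈ S.set n) :
    IsUnit (S.toLoc n a) := by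
  rw [← toLoc_transition]
  exact (S.isUnit_transition ha).map _

/-- A homomorphism out of `A_S` is determined by its restriction to `A`. -/
theorem loc_hom_ext {S : FullSpectrum A} {f g : S.loc →+* R}
    (h : f.comp S.of = g.comp S.of) : f = g := by
  have key : ∀ n, f.comp (S.toLoc n) = g.comp (S.toLoc n) := by
    intro n
    induction n with
    | zero => exact h
    | succ n ih =>
      rw [← toLoc_comp_transition, ← RingHom.comp_assoc, ← RingHom.comp_assoc] at ih
      obtain ⟨s, B, _, _, φ, rfl⟩ := S
      exact Loc.hom_ext ih
  ext x
  obtain ⟨n, a, rfl⟩ := S.exists_toLoc_eq x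
  exact congrArg (fun k => k a) (key n)

/-- A homomorphism whose system is `S` extends to a homomorphism out of `A_S`, under which only the
elements of `S` become invertible. -/
theorem exists_loc_lift_mem_set (S : FullSpectrum A) (h : A →+* R) (hS : S.1 = system h) :
    ∃ l : S.loc →+* R, l.comp S.of = h ∧
      ∀ (n : ℕ) (a : S.ring n), IsUnit (l (S.toLoc n a)) → a ∈ S.set n := by
  obtain ⟨s, hs⟩ := S
  obtain rfl : s = system h := hS
  set S : FullSpectrum A := ⟨system h, hs⟩
  let c : Cocone S.diagram :=
    ⟨RingCat.of R, NatTrans.ofSequence (fun n => RingCat.ofHom (systemAux h n).2) (by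
      intro n
      have e : S.diagram.map (homOfLE (Nat.le_succ n)) = RingCat.ofHom (S.transition n) :=
        Functor.ofSequence_map_homOfLE_succ _ n
      rw [e]
      ext a
      exact Loc.lift_of (systemAux h n).2 (fun _ hs => hs) a)⟩
  let l : S.loc →+* R := (colimit.desc S.diagram c).hom
  have hl : ∀ n a, l (S.toLoc n a) = (systemAux h n).2 a := by
    intro n a
    exact congrArg (fun k => RingCat.Hom.hom k a) (colimit.ι_desc c n)
  refine ⟨l, RingHom.ext (hl 0), fun n a ha => ?_⟩
  rw [hl] at ha
  exact ha

/-- A homomorphism whose system is `S` extends to a local homomorphism out of `A_S`. -/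
theorem exists_loc_lift (S : FullSpectrum A) (h : A →+* R) (hS : S.1 = system h) :
    ∃ l : S.loc →+* R, l.comp S.of = h ∧ IsLocalHom l := by
  obtain ⟨l, hl, hu⟩ := S.exists_loc_lift_mem_set h hS
  refine ⟨l, hl, ⟨fun x hx => ?_⟩⟩
  obtain ⟨n, a, rfl⟩ := S.exists_toLoc_eq x
  exact S.isUnit_toLoc (hu n a hx)

/-- The system of `i_S : A → A_S` is `S` itself. -/
theorem eq_system_of (S : FullSpectrum A) : S.1 = system S.of := by
  obtain ⟨B, _, _, φ, hφ⟩ := S.2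
  obtain ⟨l, hl, _⟩ := S.exists_loc_lift φ hφ
  rw [hφ, ← hl, system_comp]

instance (S : FullSpectrum A) : Nontrivial S.loc := by
  obtain ⟨B, _, _, φ, hφ⟩ := S.2
  obtain ⟨l, -⟩ := S.exists_loc_lift φ hφ
  exact l.domain_nontrivial

theorem mem_set_iff (S : FullSpectrum A) {n : ℕ} {a : S.ring n} :
    a ∈ S.set n ↔ IsUnit (S.toLoc n a) := by
  refine ⟨S.isUnit_toLoc, fun h => ?_⟩
  obtain ⟨l, -, hu⟩ := S.exists_loc_lift_mem_set S.of S.eq_system_of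
  exact hu n a (h.map l)

/-- The system on `B` pulls back to the system of `A → B → B_S`. -/
theorem comap_eq_system (φ : A →+* B) (S : FullSpectrum B) :
    (comap φ S).1 = system (S.of.comp φ) := by
  funext n
  refine Eq.trans ?_ (congrArg Sigma.fst (pullbackAux_system φ S.of n))
  exact congrArg (fun s => (pullbackAux φ n s).1) (congrFun S.eq_system_of n)

/-- The natural homomorphism `φ^S : A_{φ^*(S)} → B_S`. -/
def comapHom (φ : A →+* B) (S : FullSpectrum B) : (comap φ S).loc →+* S.loc :=
  (exists_loc_lift _ _ (comap_eq_system φ S)).choose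

theorem comapHom_comp_of (φ : A →+* B) (S : FullSpectrum B) :
    (comapHom φ S).comp (comap φ S).of = S.of.comp φ :=
  (exists_loc_lift _ _ (comap_eq_system φ S)).choose_spec.1

instance (φ : A →+* B) (S : FullSpectrum B) : IsLocalHom (comapHom φ S) :=
  (exists_loc_lift _ _ (comap_eq_system φ S)).choose_spec.2

end FullSpectrum

end Systems

/-! ### Fractions and the topology -/

section Fractions

variable {A B R : Type u} [Ring A] [Ring B] [Ring R]

/-- The canonical homomorphism `A → (…(A_{a₁})…)_{aₙ}` attached to a fraction of `A`. -/
def fracOf : (n : ℕ) → (a : (fracTower A n).Idx) → (A →+* (fracTower A n).ring a)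
  | 0, _ => RingHom.id A
  | n + 1, a => (Loc.of ({a.2} : Set ((fracTower A n).ring a.1))).comp (fracOf n a.1)

theorem FracHom.comp_fracOf (h : A →+* R) : ∀ (n : ℕ) (a : (fracTower A n).Idx)
    (f : (fracTower A n).ring a →+* (tower A n).ring (system h n)),
    FracHom n a (system h n) f → ((systemAux h n).2.comp f).comp (fracOf n a) = h
  | 0, _, f, hf => by
    obtain rfl : f = RingHom.id A := hf
    rfl
  | n + 1, a, f, ⟨g, hg, _, hfg⟩ => by
    refine Eq.trans ?_ (FracHom.comp_fracOf h n a.1 g hg)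
    ext x
    have e := congrArg (fun k => (systemAux h (n + 1)).2 (k (fracOf n a.1 x))) hfg
    exact e.trans (Loc.lift_of (systemAux h n).2 (fun _ hs => hs) _)

theorem exists_fracHom (h : A →+* R) : ∀ (n : ℕ) (a : (fracTower A n).Idx)
    (g : (fracTower A n).ring a →+* R), g.comp (fracOf n a) = h →
    ∃ f, FracHom n a (system h n) f ∧ (systemAux h n).2.comp f = g
  | 0, _, _, hg => ⟨RingHom.id A, rfl, hg.symm⟩
  | n + 1, a, g, hg => by
    obtain ⟨f, hf, hfg⟩ := exists_fracHom h n a.1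
      (g.comp (Loc.of ({a.2} : Set ((fracTower A n).ring a.1)))) hg
    have hmem : f a.2 ∈ {x | IsUnit ((systemAux h n).2 x)} := by
      change IsUnit (((systemAux h n).2.comp f) a.2)
      rw [hfg]
      exact (Loc.isUnit_of _ (Set.mem_singleton a.2)).map g
    refine ⟨Loc.map f (by rintro s rfl; exact hmem), ⟨f, hf, hmem, ?_⟩, ?_⟩
    · ext x
      exact Loc.map_of _ _ x
    · apply Loc.hom_ext
      refine Eq.trans ?_ hfg
      ext x
      exact (congrArg (systemAux h (n + 1)).2 (Loc.map_of f _ x)).trans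
        (Loc.lift_of (systemAux h n).2 (fun _ hs => hs) _)

/-- A point `S` lies in `D(a)` if and only if `A → A_S` extends to the ring of the fraction `a`.
No condition on levels is left, since membership in `S` at any level is invertibility in `A_S`. -/
theorem mem_fundamentalOpen_iff {n : ℕ} {a : (fracTower A n).Idx} {S : FullSpectrum A} :
    S ∈ fundamentalOpen a ↔
      ∃ g : (fracTower A n).ring a →+* S.loc, g.comp (fracOf n a) = S.of := by
  -- the types depend on the initial segment `S.1 n`, so it is replaced by a variable
  have key : ∀ s : (tower A n).Idx, s = system S.of n → ((∃ f, FracHom n a s f) ↔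
      ∃ g : (fracTower A n).ring a →+* S.loc, g.comp (fracOf n a) = S.of) := by
    rintro _ rfl
    refine ⟨fun ⟨f, hf⟩ => ⟨_, FracHom.comp_fracOf S.of n a f hf⟩, fun ⟨g, hg⟩ => ?_⟩
    obtain ⟨f, hf, -⟩ := exists_fracHom S.of n a g hg
    exact ⟨f, hf⟩
  exact key _ (congrFun S.eq_system_of n)

theorem isOpen_fundamentalOpen {n : ℕ} (a : (fracTower A n).Idx) :
    IsOpen (fundamentalOpen a) :=
  isOpen_generateFrom_of_mem ⟨n, a, rfl⟩

/-- The image of a fraction of `A` under `φ : A → B`, together with the homomorphism between the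
rings of the two fractions. -/
def fracMap (φ : A →+* B) : (n : ℕ) → (a : (fracTower A n).Idx) →
    Σ b : (fracTower B n).Idx, ((fracTower A n).ring a →+* (fracTower B n).ring b)
  | 0, _ => ⟨PUnit.unit, φ⟩
  | n + 1, a => ⟨⟨(fracMap φ n a.1).1, (fracMap φ n a.1).2 a.2⟩,
      Loc.map (fracMap φ n a.1).2 (by rintro s rfl; rfl)⟩

theorem fracMap_comp_fracOf (φ : A →+* B) : ∀ (n : ℕ) (a : (fracTower A n).Idx),
    (fracMap φ n a).2.comp (fracOf n a) = (fracOf n (fracMap φ n a).1).comp φ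
  | 0, _ => rfl
  | n + 1, a => by
    ext x
    exact (Loc.map_of (fracMap φ n a.1).2 (by rintro s rfl; rfl) (fracOf n a.1 x)).trans
      (congrArg (fun k => Loc.of _ (k x)) (fracMap_comp_fracOf φ n a.1))

/-- The ring of the image of a fraction `a` is the pushout of the ring of `a` along `φ`. -/
theorem exists_fracMap_lift (φ : A →+* B) (h : B →+* R) : ∀ (n : ℕ) (a : (fracTower A n).Idx)
    (g : (fracTower A n).ring a →+* R), g.comp (fracOf n a) = h.comp φ →
    ∃ g' : (fracTower B n).ring (fracMap φ n a).1 →+* R,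
      g'.comp (fracOf n (fracMap φ n a).1) = h ∧ g'.comp (fracMap φ n a).2 = g
  | 0, _, _, hg => ⟨h, rfl, hg.symm⟩
  | n + 1, a, g, hg => by
    obtain ⟨g', hg', hgg'⟩ := exists_fracMap_lift φ h n a.1
      (g.comp (Loc.of ({a.2} : Set ((fracTower A n).ring a.1)))) hg
    have hu : IsUnit (g' ((fracMap φ n a.1).2 a.2)) := by
      change IsUnit ((g'.comp (fracMap φ n a.1).2) a.2)
      rw [hgg']
      exact (Loc.isUnit_of _ (Set.mem_singleton a.2)).map g
    refine ⟨Loc.lift g' (by rintro s rfl; exact hu), ?_, ?_⟩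
    · ext x
      exact (Loc.lift_of g' _ _).trans (congrArg (fun k => k x) hg')
    · apply Loc.hom_ext
      refine Eq.trans ?_ hgg'
      ext x
      exact (congrArg (Loc.lift g' _)
        (Loc.map_of (fracMap φ n a.1).2 (by rintro s rfl; rfl) x)).trans
        (Loc.lift_of g' _ _)

theorem comap_mem_fundamentalOpen_iff (φ : A →+* B) (S : FullSpectrum B) {n : ℕ}
    (a : (fracTower A n).Idx) :
    FullSpectrum.comap φ S ∈ fundamentalOpen a ↔ S ∈ fundamentalOpen (fracMap φ n a).1 := by
  rw [mem_fundamentalOpen_iff]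
  constructor
  · rintro ⟨g, hg⟩
    obtain ⟨g', hg', -⟩ := exists_fracMap_lift φ S.of n a
      ((FullSpectrum.comapHom φ S).comp g) (by
        rw [RingHom.comp_assoc, hg, FullSpectrum.comapHom_comp_of])
    exact mem_fundamentalOpen_iff.2 ⟨g', hg'⟩
  · intro hS
    obtain ⟨g, hg⟩ := mem_fundamentalOpen_iff.1 hS
    -- membership of a fraction depends on the system only, and `A → B_S` has the system `φ^*S`
    have e : (g.comp (fracMap φ n a).2).comp (fracOf n a) = S.of.comp φ := by
      rw [RingHom.comp_assoc, fracMap_comp_fracOf, ← RingHom.comp_assoc, hg]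
    obtain ⟨f, hf, -⟩ := exists_fracHom _ n a _ e
    rw [← mem_fundamentalOpen_iff]
    have key : ∀ s : (tower A n).Idx, s = system (S.of.comp φ) n → ∃ f, FracHom n a s f := by
      rintro _ rfl
      exact ⟨f, hf⟩
    exact key _ (congrFun (FullSpectrum.comap_eq_system φ S) n)

theorem continuous_comap (φ : A →+* B) : Continuous (FullSpectrum.comap φ) := by
  refine continuous_generateFrom_iff.2 ?_
  rintro _ ⟨n, a, rfl⟩
  convert isOpen_fundamentalOpen (fracMap φ n a).1 using 1
  ext S
  exact comap_mem_fundamentalOpen_iff φ S a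

end Fractions

/-! ### Solutions of polynomial presentations -/

section Presentations

variable {A B R R' : Type u} [Ring A] [Ring B] [Ring R] [Ring R']

/-- Evaluation in `R` of polynomials in elements of `A` and symbols `x_i`, along `h : A → R`. -/
def evalHom (h : A →+* R) {ι : Type} (x : ι → R) : FreeAlgebra ℤ (A ⊕ ι) →ₐ[ℤ] R :=
  FreeAlgebra.lift ℤ (Sum.elim (fun a => h a) x)

@[simp]
theorem evalHom_ι (h : A →+* R) {ι : Type} (x : ι → R) (v : A ⊕ ι) :
    evalHom h x (FreeAlgebra.ι ℤ v) = Sum.elim (fun a => h a) x v := by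
  simp [evalHom]

theorem map_evalHom (l : R →+* R') (h : A →+* R) {ι : Type} (x : ι → R)
    (p : FreeAlgebra ℤ (A ⊕ ι)) : l (evalHom h x p) = evalHom (l.comp h) (l ∘ x) p := by
  have e : l.toIntAlgHom.comp (evalHom h x) = evalHom (l.comp h) (l ∘ x) := by
    apply FreeAlgebra.hom_ext
    funext v
    rcases v with a | i <;> simp
  exact congrArg (fun k => k p) e

theorem evalHom_lift_map (h : A →+* R) {ι κ : Type} (g : ι → κ) (x : κ → R)
    (φ : B →+* A) (p : FreeAlgebra ℤ (B ⊕ ι)) :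
    evalHom h x (FreeAlgebra.lift ℤ (FreeAlgebra.ι ℤ ∘ Sum.map φ g) p) =
      evalHom (h.comp φ) (x ∘ g) p := by
  have e : (evalHom h x).comp (FreeAlgebra.lift ℤ (FreeAlgebra.ι ℤ ∘ Sum.map φ g)) =
      evalHom (h.comp φ) (x ∘ g) := by
    apply FreeAlgebra.hom_ext
    funext v
    rcases v with a | i <;> simp
  exact congrArg (fun k => k p) e

theorem evalHom_congr (h : A →+* R) {ι : Type} {x y : ι → R} {V : Set (A ⊕ ι)}
    {p : FreeAlgebra ℤ (A ⊕ ι)} (hp : p ∈ Algebra.adjoin ℤ (FreeAlgebra.ι ℤ '' V))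
    (hxy : ∀ i, Sum.inr i ∈ V → x i = y i) : evalHom h x p = evalHom h y p := by
  have e : Set.EqOn (evalHom h x) (evalHom h y) (FreeAlgebra.ι ℤ '' V) := by
    rintro _ ⟨v, hv, rfl⟩
    rcases v with a | i
    · simp
    · simpa using hxy i hv
  exact AlgHom.eqOn_adjoin_iff.2 e hp

namespace PolyPresentation

/-- `x` solves the presentation `P` over `h : A → R`: each `x i` is inverse to the value of
`den i`. -/
def Solves (P : PolyPresentation A) (h : A →+* R) (x : P.ι → R) : Prop :=
  ∀ i, evalHom h x (P.den i) * x i = 1 ∧ x i * evalHom h x (P.den i) = 1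

theorem evalHom_den_congr (P : PolyPresentation A) (h : A →+* R) {x y : P.ι → R} {i : P.ι}
    (hxy : ∀ j, P.level j < P.level i → x j = y j) :
    evalHom h x (P.den i) = evalHom h y (P.den i) :=
  evalHom_congr h (P.depends i) fun j hj => hxy j (hj j rfl)

theorem Solves.map {P : PolyPresentation A} {h : A →+* R} {x : P.ι → R} (hx : P.Solves h x)
    (l : R →+* R') : P.Solves (l.comp h) (l ∘ x) := by
  intro i
  rw [← map_evalHom, Function.comp_apply, ← map_mul, ← map_mul, (hx i).1, (hx i).2, map_one]
  exact ⟨rfl, rfl⟩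

theorem Solves.unique {P : PolyPresentation A} {h : A →+* R} {x y : P.ι → R}
    (hx : P.Solves h x) (hy : P.Solves h y) : x = y := by
  have key : ∀ N i, P.level i = N → x i = y i := by
    intro N
    induction N using Nat.strong_induction_on with
    | _ N ih =>
      rintro i rfl
      have e := P.evalHom_den_congr h (fun j hj => ih _ hj j rfl)
      have h1 := (hx i).2
      rw [e] at h1
      exact left_inv_eq_right_inv h1 (hy i).1
  exact funext fun i => key _ i rfl

/-- The level conditions in `IsSol` hold automatically: the value of `den i` comes from
`A_{S, level i}` because its symbols do, by induction on the level. -/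
theorem isSol_iff {P : PolyPresentation A} {S : FullSpectrum A} {x : P.ι → S.loc} :
    P.IsSol S x ↔ P.Solves S.of x := by
  refine ⟨fun hx i => (hx i).2, fun hx => ?_⟩
  have hmono : ∀ {m n : ℕ}, m ≤ n → (S.toLoc m).range ≤ (S.toLoc n).range := by
    intro m n hmn
    induction hmn with
    | refl => exact le_rfl
    | step _ ih =>
      refine ih.trans ?_
      rintro _ ⟨a, rfl⟩
      exact ⟨_, S.toLoc_transition _ a⟩
  have key : ∀ N i, P.level i = N →
      ∃ s ∈ S.set (P.level i), S.toLoc (P.level i) s = evalLoc S x (P.den i) := by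
    intro N
    induction N using Nat.strong_induction_on with
    | _ N ih =>
      rintro i rfl
      have hr : evalLoc S x (P.den i) ∈ (S.toLoc (P.level i)).range := by
        let Q : Subalgebra ℤ S.loc := subalgebraOfSubring (S.toLoc (P.level i)).range
        have hle : Algebra.adjoin ℤ (FreeAlgebra.ι ℤ '' {v : A ⊕ P.ι |
            ∀ j, v = Sum.inr j → P.level j < P.level i}) ≤ Q.comap (evalLoc S x) := by
          refine Algebra.adjoin_le ?_
          rintro _ ⟨v, hv, rfl⟩
          change evalHom S.of x _ ∈ (S.toLoc (P.level i)).range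
          rw [evalHom_ι]
          rcases v with a | j
          · exact hmono (Nat.zero_le _) ⟨a, rfl⟩
          · have hj := hv j rfl
            obtain ⟨s, hs, hsd⟩ := ih _ hj j rfl
            obtain ⟨w, hw⟩ := S.isUnit_transition hs
            refine hmono hj ⟨((w⁻¹ : _ˣ) : S.ring (P.level j + 1)), ?_⟩
            -- `x j` and the image of `w⁻¹` are both inverse to the value of `den j`
            refine left_inv_eq_right_inv (a := evalHom S.of x (P.den j)) ?_ (hx j).1
            have hd : evalHom S.of x (P.den j) = S.toLoc (P.level j + 1) w := by
              rw [hw, S.toLoc_transition]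
              exact hsd.symm
            rw [hd, ← map_mul, Units.inv_mul, map_one]
        exact hle (P.depends i)
      obtain ⟨s, hs⟩ := hr
      refine ⟨s, S.mem_set_iff.2 ?_, hs⟩
      rw [hs]
      exact ⟨⟨_, x i, (hx i).1, (hx i).2⟩, rfl⟩
  exact fun i => ⟨key _ i rfl, hx i⟩

theorem presents_iff {P : PolyPresentation A} {S : FullSpectrum A} {y : S.loc} :
    P.Presents S y ↔ ∃ x, P.Solves S.of x ∧ y = evalHom S.of x P.num :=
  exists_congr fun _ => and_congr isSol_iff Iff.rfl

/-- A solvable presentation is already solvable over the ring of a fraction, obtained by inverting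
the denominators one after the other, in the order of their levels. -/
theorem Solves.exists_fracOf {P : PolyPresentation A} {h : A →+* R} {x : P.ι → R}
    (hx : P.Solves h x) : ∃ (n : ℕ) (a : (fracTower A n).Idx) (g : (fracTower A n).ring a →+* R),
      g.comp (fracOf n a) = h ∧ ∃ y, P.Solves (fracOf n a) y := by
  classical
  have := P.finite
  have := Fintype.ofFinite P.ι
  have key : ∀ J : Finset P.ι, (∀ i ∈ J, ∀ j, P.level j < P.level i → j ∈ J) →
      ∃ (n : ℕ) (a : (fracTower A n).Idx) (g : (fracTower A n).ring a →+* R),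
        g.comp (fracOf n a) = h ∧ ∃ y : P.ι → (fracTower A n).ring a,
          (∀ i ∈ J, evalHom (fracOf n a) y (P.den i) * y i = 1 ∧
            y i * evalHom (fracOf n a) y (P.den i) = 1) ∧ ∀ i ∈ J, g (y i) = x i := by
    intro J
    induction J using Finset.induction_on_max_value P.level with
    | empty => exact fun _ => ⟨0, PUnit.unit, h, rfl, fun _ => (0 : A), by simp, by simp⟩
    | insert i J hi hmax ih =>
      intro hJ
      obtain ⟨n, a, g, hg, y, hy, hgy⟩ := ih (by
        intro j hj k hk
        refine Finset.mem_of_mem_insert_of_ne (hJ j (Finset.mem_insert_of_mem hj) k hk) ?_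
        rintro rfl
        exact absurd (hmax j hj) (not_le.2 hk))
      set d := evalHom (fracOf n a) y (P.den i) with hd
      have hgd : g d = evalHom h x (P.den i) := by
        rw [hd, map_evalHom, hg]
        refine P.evalHom_den_congr h fun j hj => hgy j ?_
        refine Finset.mem_of_mem_insert_of_ne (hJ i (Finset.mem_insert_self _ _) j hj) ?_
        rintro rfl
        exact lt_irrefl _ hj
      have hgu : IsUnit (g d) := by
        rw [hgd]
        exact ⟨⟨_, x i, (hx i).1, (hx i).2⟩, rfl⟩
      let a' : (fracTower A (n + 1)).Idx := ⟨a, d⟩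
      let l : (fracTower A n).ring a →+* (fracTower A (n + 1)).ring a' := Loc.of {d}
      obtain ⟨w, hw⟩ : IsUnit (l d) := Loc.isUnit_of {d} rfl
      let g' : (fracTower A (n + 1)).ring a' →+* R :=
        Loc.lift g (by rintro s rfl; exact hgu)
      have hg'l : ∀ r, g' (l r) = g r := fun r => Loc.lift_of g _ r
      let y' : P.ι → (fracTower A (n + 1)).ring a' :=
        Function.update (l ∘ y) i ((w⁻¹ : _ˣ) : (fracTower A (n + 1)).ring a')
      have hne : ∀ j, j ≠ i → y' j = l (y j) := fun j hj => Function.update_of_ne hj _ _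
      have hyi : y' i = ((w⁻¹ : _ˣ) : (fracTower A (n + 1)).ring a') := Function.update_self _ _ _
      have hden : ∀ j, P.level j ≤ P.level i →
          evalHom (fracOf (n + 1) a') y' (P.den j) = l (evalHom (fracOf n a) y (P.den j)) := by
        intro j hj
        rw [map_evalHom]
        refine P.evalHom_den_congr _ fun k hk => hne k ?_
        rintro rfl
        exact absurd hj (not_le.2 hk)
      have hlast : g' (y' i) = x i := by
        refine left_inv_eq_right_inv (a := g d) ?_ ?_
        · rw [← hg'l, ← map_mul, hyi, ← hw, Units.inv_mul, map_one]
        · rw [hgd, (hx i).1]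
      refine ⟨n + 1, a', g', ?_, y', ?_, ?_⟩
      · rw [← hg]
        ext r
        exact hg'l _
      · intro j hj
        rcases eq_or_ne j i with rfl | hji
        · rw [hden j le_rfl, ← hd, hyi, ← hw, Units.inv_mul, Units.mul_inv]
          exact ⟨rfl, rfl⟩
        · have hj' := Finset.mem_of_mem_insert_of_ne hj hji
          rw [hden j (hmax j hj'), hne j hji, ← map_mul, ← map_mul, (hy j hj').1, (hy j hj').2,
            map_one]
          exact ⟨rfl, rfl⟩
      · intro j hj
        rcases eq_or_ne j i with rfl | hji
        · exact hlast
        · rw [hne j hji, hg'l, hgy j (Finset.mem_of_mem_insert_of_ne hj hji)]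
  obtain ⟨n, a, g, hg, y, hy, -⟩ := key Finset.univ (by simp)
  exact ⟨n, a, g, hg, y, fun i => hy i (Finset.mem_univ i)⟩

/-- The points at which a presentation is solvable form a neighbourhood of each of them. -/
theorem Solves.exists_isOpen {P : PolyPresentation A} {S : FullSpectrum A} {x : P.ι → S.loc}
    (hx : P.Solves S.of x) : ∃ U : Set (FullSpectrum A), IsOpen U ∧ S ∈ U ∧
      ∀ T ∈ U, ∃ y, P.Solves (FullSpectrum.of T) y := by
  obtain ⟨n, a, g, hg, y, hy⟩ := hx.exists_fracOf
  refine ⟨fundamentalOpen a, isOpen_fundamentalOpen a, mem_fundamentalOpen_iff.2 ⟨g, hg⟩, ?_⟩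
  intro T hT
  obtain ⟨k, hk⟩ := mem_fundamentalOpen_iff.1 hT
  exact ⟨k ∘ y, hk ▸ hy.map k⟩

/-- The presentation with the same symbols as `P` and numerator `p`. -/
def withNum (P : PolyPresentation A) (p : FreeAlgebra ℤ (A ⊕ P.ι)) : PolyPresentation A :=
  { P with num := p }

/-- The presentation obtained from `P` by adding one symbol, of a level above all others, for the
inverse of the numerator of `P`. -/
def invNum (P : PolyPresentation A) : PolyPresentation A where
  ι := Option P.ι
  finite := by
    have := P.finite
    infer_instance
  level := fun i => i.elim (sSup (Set.range P.level) + 1) P.level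
  den := fun i => FreeAlgebra.lift ℤ (FreeAlgebra.ι ℤ ∘ Sum.map id some) (i.elim P.num P.den)
  depends := by
    have := P.finite
    rintro (_ | i)
    · refine depends_map some _ _ ?_
      have e : {v : A ⊕ P.ι | ∀ j, v = Sum.inr j → P.level j < sSup (Set.range P.level) + 1} =
          Set.univ := Set.eq_univ_of_forall fun v j _ =>
        Nat.lt_succ_of_le (le_csSup (Set.finite_range P.level).bddAbove ⟨j, rfl⟩)
      change P.num ∈ Algebra.adjoin ℤ (FreeAlgebra.ι ℤ '' {v : A ⊕ P.ι |
        ∀ j, v = Sum.inr j → P.level j < sSup (Set.range P.level) + 1})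
      rw [e, Set.image_univ, FreeAlgebra.adjoin_range_ι]
      exact Algebra.mem_top
    · exact depends_map some _ _ (P.depends i)
  num := FreeAlgebra.ι ℤ (Sum.inr none)

theorem evalHom_invNum_den (P : PolyPresentation A) (h : A →+* R) (x : Option P.ι → R)
    (i : Option P.ι) :
    evalHom h x (P.invNum.den i) = evalHom h (x ∘ some) (i.elim P.num P.den) :=
  evalHom_lift_map h some x (RingHom.id A) _

theorem solves_invNum_iff (P : PolyPresentation A) (h : A →+* R) (x : Option P.ι → R) :
    P.invNum.Solves h x ↔ P.Solves h (x ∘ some) ∧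
      evalHom h (x ∘ some) P.num * x none = 1 ∧ x none * evalHom h (x ∘ some) P.num = 1 := by
  have e : P.invNum.Solves h x ↔ ∀ i : Option P.ι,
      evalHom h (x ∘ some) (i.elim P.num P.den) * x i = 1 ∧
        x i * evalHom h (x ∘ some) (i.elim P.num P.den) = 1 :=
    forall_congr' fun i => iff_of_eq
      (congrArg (fun d => d * x i = 1 ∧ x i * d = 1) (P.evalHom_invNum_den h x i))
  rw [e, Option.forall, and_comm]
  rfl

/-- The image of a presentation under a homomorphism `φ : A → B`. -/
def map (φ : A →+* B) (P : PolyPresentation A) : PolyPresentation B where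
  ι := P.ι
  finite := P.finite
  level := P.level
  den i := FreeAlgebra.lift ℤ (FreeAlgebra.ι ℤ ∘ Sum.map φ id) (P.den i)
  depends i := by
    have h := Subalgebra.mem_map.mpr ⟨_, P.depends i, (rfl :
      FreeAlgebra.lift ℤ (FreeAlgebra.ι ℤ ∘ Sum.map φ id) (P.den i) = _)⟩
    rw [AlgHom.map_adjoin (FreeAlgebra.lift ℤ (FreeAlgebra.ι ℤ ∘ Sum.map φ id))] at h
    refine Algebra.adjoin_mono ?_ h
    rintro _ ⟨_, ⟨v, hv, rfl⟩, rfl⟩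
    refine ⟨Sum.map φ id v, ?_, by simp⟩
    rintro j hj
    rcases v with a | i
    · simp at hj
    · exact hv j (by simpa using hj)
  num := FreeAlgebra.lift ℤ (FreeAlgebra.ι ℤ ∘ Sum.map φ id) P.num

theorem evalHom_map_num (φ : A →+* B) (P : PolyPresentation A) (h : B →+* R) (x : P.ι → R) :
    evalHom h x (P.map φ).num = evalHom (h.comp φ) x P.num :=
  evalHom_lift_map h id x φ _

theorem solves_map_iff (φ : A →+* B) (P : PolyPresentation A) (h : B →+* R) (x : P.ι → R) :
    (P.map φ).Solves h x ↔ P.Solves (h.comp φ) x :=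
  forall_congr' fun i => iff_of_eq
    (congrArg (fun d => d * x i = 1 ∧ x i * d = 1) (evalHom_lift_map h id x φ (P.den i)))

end PolyPresentation

end Presentations

/-! ### Sections and stalks of the structure sheaf -/

section Stalks

variable {A B : Type u} [Ring A] [Ring B]

/-- Evaluation of sections at a point. -/
def evalSection (U : Opens (FTop A)) (S : FullSpectrum A) (hS : (S : FTop A) ∈ U) :
    sections U →+* S.loc :=
  (Pi.evalRingHom (fun T : U => locAt T.1) ⟨S, hS⟩).comp (sections U).subtype

theorem sections_ext {U : Opens (FTop A)} {s t : sections U}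
    (h : ∀ (S : FullSpectrum A) (hS : (S : FTop A) ∈ U),
      evalSection U S hS s = evalSection U S hS t) : s = t :=
  Subtype.ext (funext fun S => h S.1 S.2)

/-- The section over `U` with the value `i_S(a)` at `S`. -/
def constSection (U : Opens (FTop A)) : A →+* sections U where
  toFun a := ⟨fun S => FullSpectrum.of (A := A) S.1 a, by
    have h := presentedLocal_poly (U := U) (FreeAlgebra.ι ℤ (Sum.inl a : A ⊕ Empty))
    have e : ∀ T : FullSpectrum A,
        evalLoc T Empty.elim (FreeAlgebra.ι ℤ (Sum.inl a : A ⊕ Empty)) = T.of a :=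
      fun T => evalHom_ι T.of Empty.elim (Sum.inl a)
    exact (funext fun S : U => e S.1) ▸ h⟩
  map_one' := sections_ext fun S _ => map_one S.of
  map_mul' a b := sections_ext fun S _ => map_mul S.of a b
  map_zero' := sections_ext fun S _ => map_zero S.of
  map_add' a b := sections_ext fun S _ => map_add S.of a b

theorem evalSection_comp_constSection (U : Opens (FTop A)) (S : FullSpectrum A)
    (hS : (S : FTop A) ∈ U) : (evalSection U S hS).comp (constSection U) = S.of :=
  rfl

/-- The pointwise solutions of a presentation are sections. -/
theorem PolyPresentation.exists_solves_constSection (P : PolyPresentation A) (U : Opens (FTop A))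
    (hP : ∀ S : FullSpectrum A, (S : FTop A) ∈ U → ∃ x, P.Solves S.of x) :
    ∃ x : P.ι → sections U, P.Solves (constSection U) x := by
  choose x hx using hP
  have hp : ∀ (i : P.ι) (S : FullSpectrum A) (hS : (S : FTop A) ∈ U),
      (P.withNum (FreeAlgebra.ι ℤ (Sum.inr i))).Presents S (x S hS i) := fun i S hS =>
    presents_iff.2 ⟨x S hS, hx S hS, (evalHom_ι S.of (x S hS) (Sum.inr i)).symm⟩
  let y : P.ι → sections U := fun i => ⟨fun S => x S.1 S.2 i, fun S =>
    ⟨U, S.2, 𝟙 _, P.withNum (FreeAlgebra.ι ℤ (Sum.inr i)), fun T => hp i T.1 T.2⟩⟩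
  have hy : ∀ (S : FullSpectrum A) (hS : (S : FTop A) ∈ U) (i : P.ι),
      evalSection U S hS (evalHom (constSection U) y (P.den i)) =
        evalHom S.of (x S hS) (P.den i) := fun S hS i =>
    map_evalHom (evalSection U S hS) (constSection U) y (P.den i)
  refine ⟨y, fun i => ⟨sections_ext fun S hS => ?_, sections_ext fun S hS => ?_⟩⟩
  · rw [map_mul, hy, map_one]
    exact (hx S hS i).1
  · rw [map_mul, hy, map_one]
    exact (hx S hS i).2

/-- Restriction of sections. -/
def resSection {U V : Opens (FTop A)} (i : V ⟶ U) : sections U →+* sections V :=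
  ((structurePresheaf A).map i.op).hom

/-- Near each point a section is a polynomial in constant sections and their iterated inverses. -/
theorem exists_resSection_eq_evalHom {U : Opens (FTop A)} (t : sections U) (S : FullSpectrum A)
    (hS : (S : FTop A) ∈ U) : ∃ (V : Opens (FTop A)) (_ : (S : FTop A) ∈ V) (i : V ⟶ U)
      (P : PolyPresentation A) (x : P.ι → sections V), P.Solves (constSection V) x ∧
        resSection i t = evalHom (constSection V) x P.num := by
  obtain ⟨V, hV, i, P, hP⟩ := t.2 ⟨S, hS⟩
  obtain ⟨x, hx⟩ := P.exists_solves_constSection V fun T hT => by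
    obtain ⟨x, hx, -⟩ := PolyPresentation.presents_iff.1 (hP ⟨T, hT⟩)
    exact ⟨x, hx⟩
  refine ⟨V, hV, i, P, x, hx, sections_ext fun T hT => ?_⟩
  obtain ⟨y, hy, e⟩ := PolyPresentation.presents_iff.1 (hP ⟨T, hT⟩)
  refine e.trans ?_
  rw [map_evalHom, (hx.map (evalSection V T hT)).unique hy]
  rfl

/-- The stalk `𝒪_{A,S}`. -/
abbrev stalkAt (S : FullSpectrum A) : Type u := ((F A).presheaf.stalk (S : F A) : RingCat.{u})

/-- The germ at `S` of a section. -/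
def germAt (U : Opens (FTop A)) (S : FullSpectrum A) (hS : (S : FTop A) ∈ U) :
    sections U →+* stalkAt S :=
  ((F A).presheaf.germ U S hS).hom

theorem germAt_resSection {U V : Opens (FTop A)} (i : V ⟶ U) (S : FullSpectrum A)
    (hS : (S : FTop A) ∈ V) (t : sections U) :
    germAt V S hS (resSection i t) = germAt U S (i.le hS) t :=
  (F A).presheaf.germ_res_apply i S hS t

/-- The homomorphism `A → 𝒪_{A,S}`. -/
def ofStalk (S : FullSpectrum A) : A →+* stalkAt S :=
  (germAt ⊤ S trivial).comp (constSection ⊤)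

theorem germAt_comp_constSection (U : Opens (FTop A)) (S : FullSpectrum A)
    (hS : (S : FTop A) ∈ U) : (germAt U S hS).comp (constSection U) = ofStalk S := by
  ext a
  exact germAt_resSection (homOfLE le_top : U ⟶ ⊤) S hS (constSection ⊤ a)

instance (x : F A) : Ring (FullSpectrum.loc (A := A) x) := FullSpectrum.locRing (A := A) x

/-- The evaluations at a point of the sections over its neighbourhoods. -/
def evalCocone (x : F A) : Cocone ((OpenNhds.inclusion x).op ⋙ (F A).presheaf) where
  pt := RingCat.of (FullSpectrum.loc (A := A) x)
  ι := { app := fun U => RingCat.ofHom (evalSection U.unop.1 x U.unop.2) }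

/-- The morphism out of the stalk given by `evalCocone`. -/
def evalStalkHom (x : F A) : (F A).presheaf.stalk x ⟶ (evalCocone x).pt :=
  colimit.desc _ (evalCocone x)

theorem germ_evalStalkHom (U : Opens (F A)) (x : F A) (hx : x ∈ U) :
    (F A).presheaf.germ U x hx ≫ evalStalkHom x = RingCat.ofHom (evalSection U x hx) :=
  colimit.ι_desc (evalCocone x) (op ⟨U, hx⟩)

/-- Evaluation of germs at `S`. -/
def evalStalk (S : FullSpectrum A) : stalkAt S →+* S.loc :=
  (evalStalkHom (A := A) S).hom

theorem evalStalk_germAt (U : Opens (FTop A)) (S : FullSpectrum A) (hS : (S : FTop A) ∈ U)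
    (t : sections U) : evalStalk S (germAt U S hS t) = evalSection U S hS t :=
  congrArg (fun k => RingCat.Hom.hom k t) (germ_evalStalkHom U S hS)

theorem evalStalk_comp_ofStalk (S : FullSpectrum A) : (evalStalk S).comp (ofStalk S) = S.of :=
  RingHom.ext fun a => evalStalk_germAt ⊤ S trivial (constSection ⊤ a)

theorem exists_eq_evalHom_ofStalk (S : FullSpectrum A) (z : stalkAt S) :
    ∃ (P : PolyPresentation A) (y : P.ι → stalkAt S), P.Solves (ofStalk S) y ∧
      z = evalHom (ofStalk S) y P.num := by
  obtain ⟨U, hU, t, rfl⟩ := (F A).presheaf.exists_germ_eq z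
  obtain ⟨V, hV, i, P, x, hx, e⟩ := exists_resSection_eq_evalHom t S hU
  have h := hx.map (germAt V S hV)
  rw [germAt_comp_constSection] at h
  refine ⟨P, _, h, ?_⟩
  rw [← germAt_comp_constSection V S hV, ← map_evalHom, ← e]
  exact (germAt_resSection i S hV t).symm

theorem PolyPresentation.Solves.exists_ofStalk {P : PolyPresentation A} {S : FullSpectrum A}
    {x : P.ι → S.loc} (hx : P.Solves S.of x) : ∃ y, P.Solves (ofStalk S) y := by
  obtain ⟨U, hU, hS, h⟩ := hx.exists_isOpen
  obtain ⟨y, hy⟩ := P.exists_solves_constSection ⟨U, hU⟩ h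
  have e := hy.map (germAt ⟨U, hU⟩ S hS)
  rw [germAt_comp_constSection] at e
  exact ⟨_, e⟩

/-- A germ whose value in `A_S` is invertible is invertible: its inverse is presented by adding
a symbol for the inverse of the numerator. -/
instance isLocalHom_evalStalk (S : FullSpectrum A) : IsLocalHom (evalStalk S) := by
  refine ⟨fun z hz => ?_⟩
  obtain ⟨P, y, hy, rfl⟩ := exists_eq_evalHom_ofStalk S z
  have hy' := hy.map (evalStalk S)
  rw [map_evalHom] at hz
  rw [evalStalk_comp_ofStalk] at hz hy'
  obtain ⟨w, hw⟩ := hz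
  have hs : P.invNum.Solves S.of
      (fun i : Option P.ι => i.elim ((w⁻¹ : _ˣ) : S.loc) (evalStalk S ∘ y)) := by
    refine (P.solves_invNum_iff _ _).2 ⟨hy', ?_, ?_⟩
    · exact (congrArg (· * ((w⁻¹ : _ˣ) : S.loc)) hw.symm).trans w.mul_inv
    · exact (congrArg (((w⁻¹ : _ˣ) : S.loc) * ·) hw.symm).trans w.inv_mul
  obtain ⟨y', h'⟩ := hs.exists_ofStalk
  obtain ⟨h1, h2, h3⟩ := (P.solves_invNum_iff _ _).1 h'
  rw [h1.unique hy] at h2 h3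
  exact ⟨⟨_, _, h2, h3⟩, rfl⟩

theorem eq_system_ofStalk (S : FullSpectrum A) : S.1 = system (ofStalk S) := by
  rw [← system_comp (ofStalk S) (evalStalk S), evalStalk_comp_ofStalk]
  exact S.eq_system_of

/-- The homomorphism `A_S → 𝒪_{A,S}`, inverse to the evaluation of germs. -/
def locToStalk (S : FullSpectrum A) : S.loc →+* stalkAt S :=
  (S.exists_loc_lift _ (eq_system_ofStalk S)).choose

theorem locToStalk_comp_of (S : FullSpectrum A) : (locToStalk S).comp S.of = ofStalk S :=
  (S.exists_loc_lift _ (eq_system_ofStalk S)).choose_spec.1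

theorem locToStalk_evalStalk (S : FullSpectrum A) (z : stalkAt S) :
    locToStalk S (evalStalk S z) = z := by
  obtain ⟨P, y, hy, rfl⟩ := exists_eq_evalHom_ofStalk S z
  have h := (hy.map (evalStalk S)).map (locToStalk S)
  rw [evalStalk_comp_ofStalk, locToStalk_comp_of] at h
  rw [map_evalHom, map_evalHom, evalStalk_comp_ofStalk, locToStalk_comp_of, h.unique hy]

end Stalks

/-! ### Global sections -/

section GlobalSections

variable {A : Type u} [Ring A]

/-- The point of `F(A)` defined by the identity of `A` has no neighbourhood but the whole space:
what becomes invertible at this point is invertible in `A`, hence at every point. -/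
theorem eq_univ_of_point_id_mem [Nontrivial A] {U : Set (FullSpectrum A)} (hU : IsOpen U)
    (h : FullSpectrum.point (RingHom.id A) ∈ U) : U = Set.univ := by
  induction hU with
  | basic U hU =>
    obtain ⟨n, a, rfl⟩ := hU
    obtain ⟨g, hg⟩ := mem_fundamentalOpen_iff.1 h
    obtain ⟨l, hl, -⟩ := FullSpectrum.exists_loc_lift
      (FullSpectrum.point (RingHom.id A)) (RingHom.id A) rfl
    refine Set.eq_univ_of_forall fun T => mem_fundamentalOpen_iff.2 ⟨T.of.comp (l.comp g), ?_⟩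
    rw [RingHom.comp_assoc, RingHom.comp_assoc, hg, hl, RingHom.comp_id]
  | univ => rfl
  | inter U V _ _ ihU ihV => rw [ihU h.1, ihV h.2, Set.inter_univ]
  | sUnion C _ ih =>
    obtain ⟨U, hU, hS⟩ := h
    exact Set.eq_univ_of_univ_subset (ih U hU hS ▸ Set.subset_sUnion_of_mem hU)

/-- `A` is the ring of global sections, because it is the stalk at the point of the identity,
whose only neighbourhood is the whole space. -/
theorem constSection_top_bijective : Function.Bijective (constSection (⊤ : Opens (FTop A))) := by
  rcases subsingleton_or_nontrivial A with hA | hA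
  · -- the zero ring maps to no nonzero ring, so that the space is empty
    have : IsEmpty (FullSpectrum A) := ⟨fun S =>
      zero_ne_one (α := S.loc) (by
        rw [← map_zero S.of, ← map_one S.of, Subsingleton.elim (0 : A) 1])⟩
    exact ⟨fun a b _ => Subsingleton.elim a b, fun t => ⟨0, sections_ext fun S _ =>
      isEmptyElim S⟩⟩
  · set S₀ : FullSpectrum A := FullSpectrum.point (RingHom.id A)
    obtain ⟨l, hl, -⟩ := FullSpectrum.exists_loc_lift S₀ (RingHom.id A) rfl
    refine ⟨fun a b hab => ?_, fun t => ?_⟩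
    · have e : S₀.of a = S₀.of b := congrArg (evalSection ⊤ S₀ trivial) hab
      have h := congrArg l e
      exact ((congrArg (fun k => k a) hl).symm.trans h).trans (congrArg (fun k => k b) hl)
    · obtain ⟨V, hV, i, P, x, hx, e⟩ := exists_resSection_eq_evalHom t S₀ trivial
      have hVU : ∀ T : FullSpectrum A, (T : FTop A) ∈ V := fun T =>
        (eq_univ_of_point_id_mem V.2 hV).ge (Set.mem_univ T)
      -- the solution at `S₀` descends to a solution in `A`, which specializes to every point
      have hy := (hx.map (evalSection V S₀ hV)).map l
      rw [evalSection_comp_constSection, hl] at hy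
      set y := l ∘ evalSection V S₀ hV ∘ x
      refine ⟨evalHom (RingHom.id A) y P.num, sections_ext fun T _ => ?_⟩
      have e' : evalSection ⊤ T trivial t = evalSection V T (hVU T) (resSection i t) := rfl
      change T.of _ = evalSection ⊤ T trivial t
      have hT := (hx.map (evalSection V T (hVU T))).unique (hy.map T.of)
      rw [e', e, map_evalHom, map_evalHom, hT]
      rfl

end GlobalSections

/-! ### Morphisms induced by ring homomorphisms -/

section Induced

variable {A B C : Type u} [Ring A] [Ring B] [Ring C]

open FullSpectrum

/-- Pull back of systems as a morphism of topological spaces. -/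
def comapTop (φ : A →+* B) : FTop B ⟶ FTop A :=
  TopCat.ofHom ⟨comap φ, continuous_comap φ⟩

theorem PolyPresentation.Presents.comapHom {φ : A →+* B} {S : FullSpectrum B}
    {P : PolyPresentation A} {y : (comap φ S).loc} (h : P.Presents (comap φ S) y) :
    (P.map φ).Presents S (FullSpectrum.comapHom φ S y) := by
  obtain ⟨x, hx, rfl⟩ := presents_iff.1 h
  have h := hx.map (FullSpectrum.comapHom φ S)
  rw [comapHom_comp_of] at h
  refine presents_iff.2 ⟨FullSpectrum.comapHom φ S ∘ x, (P.solves_map_iff φ _ _).2 h, ?_⟩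
  rw [map_evalHom, comapHom_comp_of]
  exact (P.evalHom_map_num φ _ _).symm

theorem presentedLocal_comapHom (φ : A →+* B) {U : Opens (FTop A)} (t : sections U) :
    (presentedLocal B).pred (fun S : (Opens.map (comapTop φ)).obj U =>
      comapHom φ S.1 (t.1 ⟨comap φ S.1, S.2⟩)) := by
  intro S
  obtain ⟨V, hV, i, P, hP⟩ := t.2 ⟨comap φ S.1, S.2⟩
  refine ⟨(Opens.map (comapTop φ)).obj V, hV, (Opens.map (comapTop φ)).map i, P.map φ, ?_⟩
  exact fun T => (hP ⟨comap φ T.1, T.2⟩).comapHom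

/-- The homomorphism `𝒪_A(U) → 𝒪_B((φ^*)⁻¹(U))` given by composing with the natural homomorphisms
`A_{φ^*(S)} → B_S`. -/
def comapSection (φ : A →+* B) (U : Opens (FTop A)) :
    sections U →+* sections ((Opens.map (comapTop φ)).obj U) where
  toFun t := ⟨fun S => comapHom φ S.1 (t.1 ⟨comap φ S.1, S.2⟩), presentedLocal_comapHom φ t⟩
  map_one' := sections_ext fun S _ => map_one (comapHom φ S)
  map_mul' s t := sections_ext fun S hS => map_mul (comapHom φ S)
    (evalSection U (comap φ S) hS s) (evalSection U (comap φ S) hS t)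
  map_zero' := sections_ext fun S _ => map_zero (comapHom φ S)
  map_add' s t := sections_ext fun S hS => map_add (comapHom φ S)
    (evalSection U (comap φ S) hS s) (evalSection U (comap φ S) hS t)

/-- The morphism `F(B) → F(A)` induced by `φ : A → B`. -/
def comapMorphism (φ : A →+* B) : F B ⟶ F A :=
  InducedCategory.homMk
    { base := comapTop φ
      c := { app := fun U => RingCat.ofHom (comapSection φ U.unop) } }

theorem isInducedBy_comapMorphism (φ : A →+* B) : IsInducedBy φ (comapMorphism φ) :=
  fun S => ⟨rfl, comapHom φ S, comapHom_comp_of φ S, fun _ _ _ => rfl⟩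

/-- A morphism into `F(A)` is determined by its effect on points and on values of sections. -/
theorem morphism_ext {f g : F B ⟶ F A} (hb : ∀ S : FullSpectrum B, f.hom.base S = g.hom.base S)
    (hc : ∀ (U : Opens (F A)) (t : (F A).presheaf.obj (op U)) (S : FullSpectrum B)
      (hf : f.hom.base S ∈ U) (hg : g.hom.base S ∈ U),
      value (f.hom.c.app (op U) t) S hf = value (g.hom.c.app (op U) t) S hg) : f = g := by
  obtain ⟨⟨b, c⟩⟩ := f
  obtain ⟨⟨b', c'⟩⟩ := g
  obtain rfl : b = b' := by
    ext S
    exact hb S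
  have h : c = c' := by
    ext U t
    exact sections_ext fun S hS => hc U t S hS hS
  rw [h]

theorem IsInducedBy.unique {φ : A →+* B} {f g : F B ⟶ F A} (hf : IsInducedBy φ f)
    (hg : IsInducedBy φ g) : f = g := by
  refine morphism_ext (fun S => ?_) fun U t S h h' => ?_
  · obtain ⟨e, -⟩ := hf S
    obtain ⟨e', -⟩ := hg S
    exact e.trans e'.symm
  · obtain ⟨e, ψ, hψ, hv⟩ := hf S
    obtain ⟨e', ψ', hψ', hv'⟩ := hg S
    have hU : (comap φ S : F A) ∈ U := e ▸ h
    rw [hv U t hU, hv' U t hU, loc_hom_ext (hψ.trans hψ'.symm)]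

/-- The homomorphism induced by a morphism on a stalk. -/
def stalkMapAt (f : F B ⟶ F A) (S : FullSpectrum B) :
    stalkAt (A := A) (f.hom.base S) →+* stalkAt S :=
  (f.hom.stalkMap (S : F B)).hom

theorem stalkMapAt_germAt (f : F B ⟶ F A) (S : FullSpectrum B) (U : Opens (FTop A))
    (hS : (f.hom.base S : FTop A) ∈ U) (t : sections U) :
    stalkMapAt f S (germAt U _ hS t) =
      germAt ((Opens.map f.hom.base).obj U) S hS ((f.hom.c.app (op U)).hom t) :=
  PresheafedSpace.stalkMap_germ_apply f.hom U S hS t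

theorem evalStalk_stalkMapAt_comapMorphism (φ : A →+* B) (S : FullSpectrum B)
    (z : stalkAt (comap φ S)) :
    evalStalk S (stalkMapAt (comapMorphism φ) S z) = comapHom φ S (evalStalk (comap φ S) z) := by
  obtain ⟨U, hU, t, rfl⟩ := (F A).presheaf.exists_germ_eq z
  refine (congrArg (evalStalk S) (stalkMapAt_germAt (comapMorphism φ) S U hU t)).trans ?_
  refine (evalStalk_germAt _ S hU _).trans ?_
  exact congrArg (comapHom φ S) (evalStalk_germAt U (comap φ S) hU t).symm

theorem isLocalMorphism_comapMorphism (φ : A →+* B) : IsLocalMorphism (comapMorphism φ) := by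
  have key : ∀ (S : FullSpectrum B) (z : stalkAt (comap φ S)),
      IsUnit (stalkMapAt (comapMorphism φ) S z) → IsUnit z := by
    intro S z hz
    have h := hz.map (evalStalk S)
    rw [evalStalk_stalkMapAt_comapMorphism] at h
    exact isUnit_of_map_unit (evalStalk (comap φ S)) _ (isUnit_of_map_unit (comapHom φ S) _ h)
  exact fun S => ⟨key S⟩

theorem IsInducedBy.isLocalMorphism {φ : A →+* B} {f : F B ⟶ F A} (hf : IsInducedBy φ f) :
    IsLocalMorphism f :=
  hf.unique (isInducedBy_comapMorphism φ) ▸ isLocalMorphism_comapMorphism φ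

/-- The homomorphism induced by a morphism on global sections. -/
def globalMap (f : F B ⟶ F A) :
    sections (⊤ : Opens (FTop A)) →+* sections (⊤ : Opens (FTop B)) :=
  (f.hom.c.app (op ⊤)).hom

/-- On global sections, the morphism induced by `φ` is `φ`. -/
theorem IsInducedBy.globalMap_comp {φ : A →+* B} {f : F B ⟶ F A} (hf : IsInducedBy φ f) :
    (globalMap f).comp (constSection ⊤) = (constSection ⊤).comp φ := by
  ext a : 1
  refine sections_ext fun S hS => ?_
  obtain ⟨_, ψ, hψ, hv⟩ := hf S
  exact (hv ⊤ (constSection ⊤ a) trivial).trans (congrArg (fun k => k a) hψ)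

/-- A local morphism is induced by the homomorphism that describes it on global sections. The local
homomorphism `A_{f(S)} ≅ 𝒪_{A,f(S)} → 𝒪_{B,S} → B_S` identifies `f(S)` with the system of
`A → B → B_S`. -/
theorem IsLocalMorphism.isInducedBy {φ : A →+* B} {f : F B ⟶ F A} (hf : IsLocalMorphism f)
    (hφ : (globalMap f).comp (constSection ⊤) = (constSection ⊤).comp φ) : IsInducedBy φ f := by
  intro S
  let T : FullSpectrum A := f.hom.base S
  have hl : IsLocalHom (stalkMapAt f S) := hf S
  have hst : (stalkMapAt f S).comp (ofStalk T) = (ofStalk S).comp φ := by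
    ext a
    refine (stalkMapAt_germAt f S ⊤ trivial (constSection ⊤ a)).trans ?_
    exact congrArg (fun k => germAt ⊤ S trivial (k a)) hφ
  let k : stalkAt T →+* S.loc := (evalStalk S).comp (stalkMapAt f S)
  have hk : IsLocalHom k := RingHom.isLocalHom_comp _ _
  have hkT : k.comp (ofStalk T) = S.of.comp φ := by
    rw [RingHom.comp_assoc, hst, ← RingHom.comp_assoc, evalStalk_comp_ofStalk]
  have hT : T = comap φ S := by
    refine Subtype.ext ?_
    rw [eq_system_ofStalk, ← system_comp (ofStalk T) k, hkT, comap_eq_system]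
  -- a variable point `T'` lets the equation `T = φ^*(S)` be substituted in the types
  have key : ∀ T' : FullSpectrum A, T = T' → ∃ ψ : T'.loc →+* S.loc, ψ.comp T'.of = S.of.comp φ ∧
      ∀ (U : Opens (F A)) (t : (F A).presheaf.obj (op U)) (hU : (T : F A) ∈ U)
        (hU' : (T' : F A) ∈ U),
        value (f.hom.c.app (op U) t) S hU = ψ (value t T' hU') := by
    rintro _ rfl
    refine ⟨k.comp (locToStalk T), by rw [RingHom.comp_assoc, locToStalk_comp_of, hkT], ?_⟩
    intro U t hU _
    have e : value t T hU = evalStalk T (germAt U T hU t) := (evalStalk_germAt U T hU t).symm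
    rw [e, RingHom.comp_apply, locToStalk_evalStalk]
    refine Eq.trans ?_ (congrArg (evalStalk S) (stalkMapAt_germAt f S U hU t)).symm
    exact (evalStalk_germAt _ S hU _).symm
  obtain ⟨ψ, hψ, hv⟩ := key _ hT
  exact ⟨hT, ψ, hψ, fun U t hU => hv U t _ hU⟩

/-- A local morphism is induced by a unique homomorphism, since `A` and `B` are the rings of global
sections. -/
theorem IsLocalMorphism.existsUnique_isInducedBy {f : F B ⟶ F A} (hf : IsLocalMorphism f) :
    ∃! φ : A →+* B, IsInducedBy φ f := by
  let e : B ≃+* sections (⊤ : Opens (FTop B)) := RingEquiv.ofBijective _ constSection_top_bijective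
  refine ⟨(e.symm : _ →+* B).comp ((globalMap f).comp (constSection ⊤)), ?_, fun φ hφ => ?_⟩
  · refine hf.isInducedBy (RingHom.ext fun a => ?_)
    exact (e.apply_symm_apply _).symm
  · ext a
    refine e.injective ?_
    refine Eq.trans ?_ (e.apply_symm_apply _).symm
    exact (congrArg (fun k => k a) hφ.globalMap_comp).symm

theorem isInducedBy_id : IsInducedBy (RingHom.id A) (𝟙 (F A)) :=
  (IsLocalMorphism.id _).isInducedBy rfl

theorem IsInducedBy.comp {φ : A →+* B} {ψ : B →+* C} {f : F B ⟶ F A} {g : F C ⟶ F B}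
    (hf : IsInducedBy φ f) (hg : IsInducedBy ψ g) : IsInducedBy (ψ.comp φ) (g ≫ f) := by
  refine (hg.isLocalMorphism.comp hf.isLocalMorphism).isInducedBy ?_
  have e : globalMap (g ≫ f) = (globalMap g).comp (globalMap f) := rfl
  rw [e, RingHom.comp_assoc, hf.globalMap_comp, ← RingHom.comp_assoc, hg.globalMap_comp,
    RingHom.comp_assoc]

end Induced

/-! ### The anti-equivalence -/

theorem isLocalMorphism_of_iso {X Y : SheafedSpace RingCat.{u}} (e : X ≅ Y) :
    IsLocalMorphism e.hom := by
  intro x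
  have : IsIso e.hom.hom := inferInstanceAs (IsIso (SheafedSpace.forgetToPresheafedSpace.map e.hom))
  refine ⟨fun a ha => ?_⟩
  have h := ha.map (inv (e.hom.hom.stalkMap x)).hom
  rwa [← RingHom.comp_apply, ← RingCat.hom_comp, IsIso.hom_inv_id] at h

/-- The contravariant functor `A ↦ F(A)` from rings to affine F-schemes. -/
def specFunctor : RingCat.{u}ᵒᵖ ⥤ AffineFScheme.{u} where
  obj A := affineF A.unop
  map φ := ⟨comapMorphism φ.unop.hom, isLocalMorphism_comapMorphism _⟩
  map_id _ := Subtype.ext ((isInducedBy_comapMorphism _).unique isInducedBy_id)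
  map_comp φ ψ := Subtype.ext ((isInducedBy_comapMorphism _).unique
    ((isInducedBy_comapMorphism ψ.unop.hom).comp (isInducedBy_comapMorphism φ.unop.hom)))

instance : specFunctor.{u}.Faithful where
  map_injective {A B φ ψ} h := by
    have e : comapMorphism φ.unop.hom = comapMorphism ψ.unop.hom := congrArg Subtype.val h
    have := (isLocalMorphism_comapMorphism φ.unop.hom).existsUnique_isInducedBy.unique
      (isInducedBy_comapMorphism _) (e ▸ isInducedBy_comapMorphism ψ.unop.hom)
    exact Quiver.Hom.unop_inj (RingCat.hom_ext this)

instance : specFunctor.{u}.Full where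
  map_surjective {A B} f := by
    obtain ⟨φ, hφ, -⟩ := IsLocalMorphism.existsUnique_isInducedBy (A := B.unop) (B := A.unop) f.2
    exact ⟨(RingCat.ofHom φ).op, Subtype.ext ((isInducedBy_comapMorphism φ).unique hφ)⟩

instance : specFunctor.{u}.EssSurj where
  mem_essImage X := by
    obtain ⟨A, _, ⟨e⟩⟩ := X.isAffine
    exact ⟨op (RingCat.of A), ⟨
      { hom := ⟨e.inv, isLocalMorphism_of_iso e.symm⟩
        inv := ⟨e.hom, isLocalMorphism_of_iso e⟩
        hom_inv_id := Subtype.ext e.inv_hom_id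
        inv_hom_id := Subtype.ext e.hom_inv_id }⟩⟩

end

end FSch

theorem mainTheorem1 :
    (∀ (A B : Type u) [Ring A] [Ring B] (φ : A →+* B),
      ∃ f : FSch.F B ⟶ FSch.F A, FSch.IsLocalMorphism f ∧ FSch.IsInducedBy φ f ∧
        ∀ g : FSch.F B ⟶ FSch.F A, FSch.IsInducedBy φ g → g = f) ∧
    (∀ (A B : Type u) [Ring A] [Ring B] (f : FSch.F B ⟶ FSch.F A),
      FSch.IsLocalMorphism f → ∃! φ : A →+* B, FSch.IsInducedBy φ f) ∧
    (∃ (G : RingCat.{u}ᵒᵖ ⥤ FSch.AffineFScheme.{u})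
      (h : ∀ A : RingCat.{u}, G.obj (op A) = FSch.affineF A),
      (∀ (A B : RingCat.{u}) (φ : A ⟶ B),
        FSch.IsInducedBy φ.hom
          (eqToHom (h B).symm ≫ G.map φ.op ≫ eqToHom (h A)).1) ∧
      G.IsEquivalence) := by
  refine ⟨fun A B _ _ φ => ⟨FSch.comapMorphism φ, FSch.isLocalMorphism_comapMorphism φ,
    FSch.isInducedBy_comapMorphism φ, fun g hg => hg.unique (FSch.isInducedBy_comapMorphism φ)⟩,
    fun A B _ _ f hf => hf.existsUnique_isInducedBy,
    FSch.specFunctor, fun A => rfl, fun A B φ => ?_, { }⟩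
  let m : FSch.affineF B ⟶ FSch.affineF A := FSch.specFunctor.map φ.op
  change FSch.IsInducedBy φ.hom (𝟙 (FSch.affineF B) ≫ m ≫ 𝟙 (FSch.affineF A)).1
  rw [Category.id_comp, Category.comp_id]
  exact FSch.isInducedBy_comapMorphism φ.hom
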